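/- For $n\in\mathbb N$ let $\mathbb B_n$ be the open unit ball of $\mathbb C^n$, $v$ the Lebesgue measure on $\mathbb B_n$ normalized so that $v(\mathbb B_n)=1$, and $L_a^2(\mathbb B_n)=\{f \text{ holomorphic on } \mathbb B_n : \int_{\mathbb B_n}|f|^2\,dv<\infty\}$ the Bergman space, with the inner product of $L^2(v)$ and the reproducing kernels $K_\lambda(w)=(1-\langle w,\lambda\rangle)^{-(n+1)}$, $\lambda,w\in\mathbb B_n$. For linear subspaces $\tilde M_1,\tilde M_2$ of $\mathbb C^n$ put $\tilde M_3=\tilde M_1\cap\tilde M_2$, $M_i=\tilde M_i\cap\mathbb B_n$ and $$Q_i=\overline{\operatorname{span}}\{K_\lambda:\lambda\in M_i\}\subseteq L_a^2(\mathbb B_n),\qquad i=1,2,3,$$ and write $Q_i$ also for the orthogonal projection of $L_a^2(\mathbb B_n)$ onto this subspace. The angle between $\tilde M_1$ and $\tilde M_2$ is $$\theta(\tilde M_1,\tilde M_2)=\arccos\,\sup\Big\{\frac{|\langle u,x\rangle|}{\|u\|\,\|x\|} : 0\ne u\in\tilde M_1\ominus\tilde M_3,\ 0\ne x\in\tilde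 M_2\ominus\tilde M_3\Big\},$$ where the supremum is read as $0$ if there are no such $u,x$. There is a function $a$ of the angle alone such that, for every $n$ and all linear subspaces $\tilde M_1,\tilde M_2$ of $\mathbb C^n$, $$\|Q_2Q_1Q_2-Q_3\|\le a\big(\theta(\tilde M_1,\tilde M_2)\big)<1 .$$ Consequently $Q_1+Q_2$ is closed and $Q_1\cap Q_2=Q_3$. -/

import Mathlib

open MeasureTheory Metric Filter Topology

/-- Normalized Lebesgue measure on the open unit ball of `ℂⁿ`, as a measure on `ℂⁿ` that gives
no mass to the complement of the ball. -/
noncomputable def ballMeasure (n : ℕ) : Measure (EuclideanSpace ℂ (Fin n)) :=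
  (volume (ball (0 : EuclideanSpace ℂ (Fin n)) 1))⁻¹ •
    volume.restrict (ball (0 : EuclideanSpace ℂ (Fin n)) 1)

theorem volume_ball_ne_zero {n : ℕ} (z : EuclideanSpace ℂ (Fin n)) {r : ℝ} (hr : 0 < r) :
    volume (ball z r) ≠ 0 := (measure_ball_pos volume z hr).ne'

theorem volume_ball_ne_top {n : ℕ} (z : EuclideanSpace ℂ (Fin n)) (r : ℝ) :
    volume (ball z r) ≠ ⊤ := measure_ball_lt_top.ne

instance instIsProbabilityMeasureBallMeasure (n : ℕ) : IsProbabilityMeasure (ballMeasure n) where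
  measure_univ := by
    simp only [ballMeasure, Measure.smul_apply, Measure.restrict_apply_univ, smul_eq_mul]
    exact ENNReal.inv_mul_cancel (volume_ball_ne_zero _ one_pos) (volume_ball_ne_top _ _)

theorem ae_ballMeasure_mem (n : ℕ) :
    ∀ᵐ z ∂(ballMeasure n), z ∈ ball (0 : EuclideanSpace ℂ (Fin n)) 1 :=
  Measure.ae_smul_measure (ae_restrict_mem measurableSet_ball) _

theorem aestronglyMeasurable_ballMeasure {n : ℕ} {f : EuclideanSpace ℂ (Fin n) → ℂ}
    (hf : ContinuousOn f (ball 0 1)) : AEStronglyMeasurable f (ballMeasure n) :=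
  (hf.aestronglyMeasurable measurableSet_ball).smul_measure _

/-- The Bergman space of the unit ball of `ℂⁿ`: the square integrable functions on the ball that
are holomorphic there (functions that agree almost everywhere on the ball being identified, as in
`L²`), with the norm and inner product of `L²`. -/
noncomputable def bergmanSpace (n : ℕ) : Submodule ℂ (Lp ℂ 2 (ballMeasure n)) where
  carrier := {F | ∃ f : EuclideanSpace ℂ (Fin n) → ℂ,
    DifferentiableOn ℂ f (ball 0 1) ∧ F =ᵐ[ballMeasure n] f}
  add_mem' := by
    rintro F G ⟨f, hf, hFf⟩ ⟨g, hg, hGg⟩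
    exact ⟨f + g, hf.add hg, (Lp.coeFn_add F G).trans (hFf.add hGg)⟩
  zero_mem' := ⟨0, differentiableOn_const 0, Lp.coeFn_zero _ _ _⟩
  smul_mem' := by
    rintro c F ⟨f, hf, hFf⟩
    exact ⟨c • f, hf.const_smul c, (Lp.coeFn_smul c F).trans (hFf.const_smul c)⟩

/-! Completeness of the Bergman space, through the sub-mean value property. -/

theorem enorm_mul_le_lintegral_circle {n : ℕ} {f : EuclideanSpace ℂ (Fin n) → ℂ}
    {z : EuclideanSpace ℂ (Fin n)} {r : ℝ} (hf : DifferentiableOn ℂ f (ball z r))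
    {w : EuclideanSpace ℂ (Fin n)} (hw : w ∈ ball (0 : EuclideanSpace ℂ (Fin n)) r) :
    ENNReal.ofReal (2 * Real.pi) * ‖f z‖ₑ ≤
      ∫⁻ θ in Set.Ioc 0 (2 * Real.pi), ‖f (z + circleMap 0 1 θ • w)‖ₑ := by
  have hw' : ‖w‖ < r := by simpa using hw
  have hmaps : Set.MapsTo (fun t : ℂ => z + t • w) (closedBall 0 1) (ball z r) := by
    intro t ht
    have ht' : ‖t‖ ≤ 1 := by simpa using ht
    have : ‖t • w‖ < r := by
      rw [norm_smul]
      exact lt_of_le_of_lt (mul_le_of_le_one_left (norm_nonneg _) ht') hw'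
    simpa using this
  have hd : DifferentiableOn ℂ (fun t : ℂ => f (z + t • w)) (closedBall 0 1) :=
    hf.comp (by fun_prop) hmaps
  have hdc : DiffContOnCl ℂ (fun t : ℂ => f (z + t • w)) (ball 0 |1|) := by
    apply DifferentiableOn.diffContOnCl
    rw [abs_one, closure_ball _ one_ne_zero]
    exact hd
  have hm := hdc.circleAverage
  rw [Real.circleAverage_def] at hm
  simp only [zero_smul, add_zero] at hm
  have h2 : (∫ θ in (0 : ℝ)..2 * Real.pi, f (z + circleMap 0 1 θ • w)) =
      (2 * Real.pi) • f z := by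
    rw [← hm, smul_smul, mul_inv_cancel₀ (by positivity), one_smul]
  rw [intervalIntegral.integral_of_le (by positivity)] at h2
  have h3 := enorm_integral_le_lintegral_enorm (μ := volume.restrict (Set.Ioc 0 (2 * Real.pi)))
    (fun θ => f (z + circleMap 0 1 θ • w))
  rw [h2, enorm_smul, Real.enorm_of_nonneg (by positivity)] at h3
  exact h3

theorem lintegral_circle_smul {n : ℕ} (θ : ℝ)
    (h : EuclideanSpace ℂ (Fin n) → ENNReal) (hh : Measurable h) :
    ∫⁻ w, h (circleMap 0 1 θ • w) = ∫⁻ w, h w := by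
  have hc : ‖circleMap 0 1 θ‖ = 1 := by simp
  let L : EuclideanSpace ℂ (Fin n) →ₗᵢ[ℝ] EuclideanSpace ℂ (Fin n) :=
    { toFun := fun w => circleMap 0 1 θ • w
      map_add' := fun x y => smul_add _ x y
      map_smul' := fun c x => smul_comm _ c x
      norm_map' := fun x => by
        change ‖circleMap 0 1 θ • x‖ = ‖x‖
        rw [norm_smul, hc, one_mul] }
  exact ((L.toLinearIsometryEquiv rfl).measurePreserving).lintegral_comp hh

theorem enorm_mul_volume_le {n : ℕ} {f : EuclideanSpace ℂ (Fin n) → ℂ}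
    {z : EuclideanSpace ℂ (Fin n)} {r : ℝ} (hf : DifferentiableOn ℂ f (ball z r)) :
    ‖f z‖ₑ * volume (ball (0 : EuclideanSpace ℂ (Fin n)) r) ≤ ∫⁻ w in ball z r, ‖f w‖ₑ := by
  classical
  set g : EuclideanSpace ℂ (Fin n) → ℂ := (ball z r).piecewise f 0 with hg
  have hgm : Measurable g :=
    hf.continuousOn.measurable_piecewise continuousOn_const measurableSet_ball
  have hgE : Measurable (fun w => ‖g w‖ₑ) := hgm.enorm
  have hgd : DifferentiableOn ℂ g (ball z r) :=
    hf.congr fun x hx => Set.piecewise_eq_of_mem _ _ _ hx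
  have hint : ∫⁻ w, ‖g w‖ₑ = ∫⁻ w in ball z r, ‖f w‖ₑ := by
    rw [← lintegral_indicator measurableSet_ball]
    congr 1
    ext w
    by_cases hw : w ∈ ball z r
    · rw [hg, Set.piecewise_eq_of_mem _ _ _ hw, Set.indicator_of_mem hw]
    · rw [hg, Set.piecewise_eq_of_notMem _ _ _ hw, Set.indicator_of_notMem hw]
      simp
  have hshift : Measurable (fun w => ‖g (z + w)‖ₑ) := hgE.comp (measurable_const_add z)
  by_cases hr : 0 < r
  swap
  · have : ball (0 : EuclideanSpace ℂ (Fin n)) r = ∅ := ball_eq_empty.2 (not_lt.1 hr)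
    simp [this]
  have hgz : g z = f z := Set.piecewise_eq_of_mem _ _ _ (mem_ball_self hr)
  have hpi : ENNReal.ofReal (2 * Real.pi) ≠ 0 := by
    rw [Ne, ENNReal.ofReal_eq_zero, not_le]
    positivity
  have hjm : Measurable (Function.uncurry
      fun (w : EuclideanSpace ℂ (Fin n)) (θ : ℝ) => ‖g (z + circleMap 0 1 θ • w)‖ₑ) := by
    apply hshift.comp
    apply Continuous.measurable
    exact ((continuous_circleMap 0 1).comp continuous_snd).smul continuous_fst
  have key : ENNReal.ofReal (2 * Real.pi) *
        (‖f z‖ₑ * volume (ball (0 : EuclideanSpace ℂ (Fin n)) r)) ≤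
      ENNReal.ofReal (2 * Real.pi) * ∫⁻ w in ball z r, ‖f w‖ₑ := by
    calc ENNReal.ofReal (2 * Real.pi) *
          (‖f z‖ₑ * volume (ball (0 : EuclideanSpace ℂ (Fin n)) r))
        = ∫⁻ _ in ball (0 : EuclideanSpace ℂ (Fin n)) r,
            ENNReal.ofReal (2 * Real.pi) * ‖g z‖ₑ := by
          rw [setLIntegral_const, hgz, mul_assoc]
      _ ≤ ∫⁻ w in ball (0 : EuclideanSpace ℂ (Fin n)) r,
            ∫⁻ θ in Set.Ioc 0 (2 * Real.pi), ‖g (z + circleMap 0 1 θ • w)‖ₑ :=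
          setLIntegral_mono' measurableSet_ball
            fun w hw => enorm_mul_le_lintegral_circle hgd hw
      _ ≤ ∫⁻ w, ∫⁻ θ in Set.Ioc 0 (2 * Real.pi), ‖g (z + circleMap 0 1 θ • w)‖ₑ :=
          setLIntegral_le_lintegral _ _
      _ = ∫⁻ θ in Set.Ioc 0 (2 * Real.pi), ∫⁻ w, ‖g (z + circleMap 0 1 θ • w)‖ₑ :=
          lintegral_lintegral_swap hjm.aemeasurable
      _ = ∫⁻ _ in Set.Ioc 0 (2 * Real.pi), ∫⁻ w in ball z r, ‖f w‖ₑ := by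
          congr 1
          ext θ
          rw [lintegral_circle_smul θ (fun w => ‖g (z + w)‖ₑ) hshift,
            lintegral_add_left_eq_self (fun w => ‖g w‖ₑ) z, hint]
      _ = ENNReal.ofReal (2 * Real.pi) * ∫⁻ w in ball z r, ‖f w‖ₑ := by
          rw [setLIntegral_const, Real.volume_Ioc, sub_zero, mul_comm]
  exact (ENNReal.mul_le_mul_iff_right hpi ENNReal.ofReal_ne_top).1 key

theorem exists_norm_le_of_ball_subset (n : ℕ) {r : ℝ} (hr : 0 < r) :
    ∃ C : ℝ, 0 ≤ C ∧ ∀ (F : Lp ℂ 2 (ballMeasure n)) (f : EuclideanSpace ℂ (Fin n) → ℂ),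
      DifferentiableOn ℂ f (ball 0 1) → F =ᵐ[ballMeasure n] f →
      ∀ z : EuclideanSpace ℂ (Fin n), ball z r ⊆ ball 0 1 → ‖f z‖ ≤ C * ‖F‖ := by
  set V1 := volume (ball (0 : EuclideanSpace ℂ (Fin n)) 1) with hV1
  set Vr := volume (ball (0 : EuclideanSpace ℂ (Fin n)) r) with hVr
  have hV1t : V1 ≠ ⊤ := volume_ball_ne_top _ _
  have hV10 : V1 ≠ 0 := volume_ball_ne_zero _ one_pos
  have hVrt : Vr ≠ ⊤ := volume_ball_ne_top _ _
  have hVr0 : Vr ≠ 0 := volume_ball_ne_zero _ hr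
  refine ⟨(V1 / Vr).toReal, ENNReal.toReal_nonneg, fun F f hf hFf z hz => ?_⟩
  have h1 : ‖f z‖ₑ * Vr ≤ V1 * ‖F‖ₑ := by
    calc ‖f z‖ₑ * Vr ≤ ∫⁻ w in ball z r, ‖f w‖ₑ := enorm_mul_volume_le (hf.mono hz)
      _ ≤ ∫⁻ w in ball 0 1, ‖f w‖ₑ := lintegral_mono_set hz
      _ = V1 * eLpNorm f 1 (ballMeasure n) := by
          rw [eLpNorm_one_eq_lintegral_enorm, ballMeasure, lintegral_smul_measure, smul_eq_mul,
            ← mul_assoc, ENNReal.mul_inv_cancel hV10 hV1t, one_mul]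
      _ ≤ V1 * eLpNorm f 2 (ballMeasure n) := by
          gcongr
          exact eLpNorm_le_eLpNorm_of_exponent_le one_le_two
            (aestronglyMeasurable_ballMeasure hf.continuousOn)
      _ = V1 * ‖F‖ₑ := by rw [Lp.enorm_def, eLpNorm_congr_ae hFf]
  have h2 : ‖f z‖ₑ ≤ V1 / Vr * ‖F‖ₑ := by
    rw [div_eq_mul_inv, mul_right_comm, ← div_eq_mul_inv]
    exact (ENNReal.le_div_iff_mul_le (Or.inl hVr0) (Or.inl hVrt)).2 h1
  have h3 := ENNReal.toReal_mono
    (ENNReal.mul_ne_top (ENNReal.div_ne_top hV1t hVr0) enorm_ne_top) h2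
  simpa [ENNReal.toReal_mul] using h3

theorem exists_norm_fderiv_le_of_ball_subset (n : ℕ) {r : ℝ} (hr : 0 < r) :
    ∃ C : ℝ, 0 ≤ C ∧ ∀ (F : Lp ℂ 2 (ballMeasure n)) (f : EuclideanSpace ℂ (Fin n) → ℂ),
      DifferentiableOn ℂ f (ball 0 1) → F =ᵐ[ballMeasure n] f →
      ∀ z : EuclideanSpace ℂ (Fin n), ball z (r + r) ⊆ ball 0 1 →
        ‖fderiv ℂ f z‖ ≤ C * ‖F‖ := by
  obtain ⟨C, hC, h⟩ := exists_norm_le_of_ball_subset n hr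
  refine ⟨(C + C) / r, by positivity, fun F f hf hFf z hz => ?_⟩
  have hsub : ∀ y ∈ ball z r, ball y r ⊆ ball 0 1 := fun y hy =>
    (ball_subset_ball' (by linarith [mem_ball.1 hy])).trans hz
  have hb : ∀ y ∈ ball z r, ‖f y‖ ≤ C * ‖F‖ := fun y hy => h F f hf hFf y (hsub y hy)
  have := Complex.norm_fderiv_le_div_of_mapsTo_ball (f := f) (c := z) (R₁ := r)
    (R₂ := (C + C) * ‖F‖) (hf.mono (hsub z (mem_ball_self hr))) (fun y hy => by
      rw [mem_closedBall, dist_eq_norm]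
      linarith [norm_sub_le (f y) (f z), hb y hy, hb z (mem_ball_self hr)]) hr
  rwa [div_mul_eq_mul_div]

theorem isClosed_bergmanSpace (n : ℕ) :
    IsClosed (bergmanSpace n : Set (Lp ℂ 2 (ballMeasure n))) := by
  apply IsSeqClosed.isClosed
  intro F F' hF hlim
  choose g hgd hgF using hF
  have hCau := hlim.cauchySeq
  have hsubd : ∀ k l, DifferentiableOn ℂ (g k - g l) (ball 0 1) := fun k l =>
    (hgd k).sub (hgd l)
  have hsubF : ∀ k l, (F k - F l : Lp ℂ 2 (ballMeasure n)) =ᵐ[ballMeasure n] g k - g l :=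
    fun k l => (Lp.coeFn_sub _ _).trans ((hgF k).sub (hgF l))
  have hrad : ∀ x ∈ ball (0 : EuclideanSpace ℂ (Fin n)) 1, ∃ r : ℝ, 0 < r ∧
      ∀ z ∈ ball x r, ball z (r + r) ⊆ ball 0 1 := by
    intro x hx
    have hx' : ‖x‖ < 1 := by simpa using hx
    refine ⟨(1 - ‖x‖) / 3, by linarith, fun z hz => ball_subset_ball' ?_⟩
    have h1 : dist z 0 ≤ dist z x + dist x 0 := dist_triangle _ _ _
    have h2 : dist x 0 = ‖x‖ := dist_zero_right x
    have h3 := mem_ball.1 hz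
    linarith
  have hpt : ∀ x ∈ ball (0 : EuclideanSpace ℂ (Fin n)) 1, CauchySeq fun k => g k x := by
    intro x hx
    obtain ⟨r, hr, hsub⟩ := hrad x hx
    obtain ⟨C, hC, h⟩ := exists_norm_le_of_ball_subset n hr
    rw [Metric.cauchySeq_iff] at hCau ⊢
    intro ε hε
    obtain ⟨N, hN⟩ := hCau (ε / (C + 1)) (by positivity)
    refine ⟨N, fun k hk l hl => ?_⟩
    have h1 := h _ _ (hsubd k l) (hsubF k l) x
      ((ball_subset_ball (by linarith)).trans (hsub x (mem_ball_self hr)))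
    have h2 := hN k hk l hl
    rw [dist_eq_norm, lt_div_iff₀ (by positivity)] at h2
    rw [dist_eq_norm]
    have h3 := norm_nonneg (F k - F l)
    rw [Pi.sub_apply] at h1
    nlinarith
  have hder : ∀ x ∈ ball (0 : EuclideanSpace ℂ (Fin n)) 1, ∃ r : ℝ, 0 < r ∧
      ball x r ⊆ ball 0 1 ∧
      UniformCauchySeqOn (fun k z => fderiv ℂ (g k) z) atTop (ball x r) := by
    intro x hx
    obtain ⟨r, hr, hsub⟩ := hrad x hx
    have hsub1 : ball x r ⊆ ball 0 1 := fun z hz => hsub z hz (mem_ball_self (by linarith))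
    refine ⟨r, hr, hsub1, ?_⟩
    obtain ⟨C, hC, h⟩ := exists_norm_fderiv_le_of_ball_subset n hr
    rw [Metric.cauchySeq_iff] at hCau
    rw [Metric.uniformCauchySeqOn_iff]
    intro ε hε
    obtain ⟨N, hN⟩ := hCau (ε / (C + 1)) (by positivity)
    refine ⟨N, fun k hk l hl z hz => ?_⟩
    have h1 := h _ _ (hsubd k l) (hsubF k l) z (hsub z hz)
    have hdk := (hgd k).differentiableAt (isOpen_ball.mem_nhds (hsub1 hz))
    have hdl := (hgd l).differentiableAt (isOpen_ball.mem_nhds (hsub1 hz))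
    rw [fderiv_sub hdk hdl] at h1
    have h2 := hN k hk l hl
    rw [dist_eq_norm, lt_div_iff₀ (by positivity)] at h2
    rw [dist_eq_norm]
    have h3 := norm_nonneg (F k - F l)
    nlinarith
  have hlimg : ∀ x, ∃ y, x ∈ ball (0 : EuclideanSpace ℂ (Fin n)) 1 →
      Tendsto (fun k => g k x) atTop (𝓝 y) := by
    intro x
    by_cases hx : x ∈ ball (0 : EuclideanSpace ℂ (Fin n)) 1
    · obtain ⟨y, hy⟩ := cauchySeq_tendsto_of_complete (hpt x hx)
      exact ⟨y, fun _ => hy⟩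
    · exact ⟨0, fun h => absurd h hx⟩
  choose G hG using hlimg
  refine ⟨G, fun x hx => ?_, ?_⟩
  · obtain ⟨r, hr, hsub1, hU⟩ := hder x hx
    have hlim' : ∀ z, ∃ y, z ∈ ball x r →
        Tendsto (fun k => fderiv ℂ (g k) z) atTop (𝓝 y) := by
      intro z
      by_cases hz : z ∈ ball x r
      · obtain ⟨y, hy⟩ := cauchySeq_tendsto_of_complete (hU.cauchySeq hz)
        exact ⟨y, fun _ => hy⟩
      · exact ⟨0, fun h => absurd h hz⟩
    choose G' hG' using hlim'
    have := hasFDerivAt_of_tendstoUniformlyOn (x := x) isOpen_ball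
      (hU.tendstoUniformlyOn_of_tendsto fun z hz => hG' z hz)
      (fun k z hz =>
        ((hgd k).differentiableAt (isOpen_ball.mem_nhds (hsub1 hz))).hasFDerivAt)
      (fun z hz => hG z (hsub1 hz)) (mem_ball_self hr)
    exact this.differentiableAt.differentiableWithinAt
  · obtain ⟨ns, hns, hae⟩ := (tendstoInMeasure_of_tendsto_Lp hlim).exists_seq_tendsto_ae
    filter_upwards [hae, ae_all_iff.2 hgF, ae_ballMeasure_mem n] with x h1 h2 h3
    refine tendsto_nhds_unique h1 ?_
    simp only [h2]
    exact (hG x h3).comp hns.tendsto_atTop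

instance instCompleteSpaceBergmanSpace (n : ℕ) : CompleteSpace (bergmanSpace n) :=
  (isClosed_bergmanSpace n).completeSpace_coe

/-- The Bergman kernel `K_z(w) = (1 - ⟨w, z⟩)^{-(n+1)}`; Mathlib's inner product is linear in
its second argument. -/
noncomputable def bergmanKernelFun {n : ℕ} (z w : EuclideanSpace ℂ (Fin n)) : ℂ :=
  1 / (1 - inner ℂ z w) ^ (n + 1)

theorem norm_inner_le_of_mem_ball {n : ℕ} {z w : EuclideanSpace ℂ (Fin n)}
    (hw : w ∈ ball (0 : EuclideanSpace ℂ (Fin n)) 1) : ‖(inner ℂ z w : ℂ)‖ ≤ ‖z‖ := by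
  have hw' : ‖w‖ < 1 := by simpa using hw
  exact (norm_inner_le_norm z w).trans (mul_le_of_le_one_right (norm_nonneg _) hw'.le)

theorem sub_norm_le_norm_one_sub_inner {n : ℕ} {z w : EuclideanSpace ℂ (Fin n)}
    (hw : w ∈ ball (0 : EuclideanSpace ℂ (Fin n)) 1) :
    1 - ‖z‖ ≤ ‖(1 : ℂ) - inner ℂ z w‖ := by
  have h1 := norm_sub_norm_le (1 : ℂ) (inner ℂ z w)
  rw [norm_one] at h1
  linarith [norm_inner_le_of_mem_ball (z := z) hw]

theorem differentiableOn_bergmanKernelFun {n : ℕ} {z : EuclideanSpace ℂ (Fin n)}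
    (hz : ‖z‖ < 1) : DifferentiableOn ℂ (bergmanKernelFun z) (ball 0 1) := by
  have hinner : Differentiable ℂ (fun w : EuclideanSpace ℂ (Fin n) => (inner ℂ z w : ℂ)) :=
    (innerSL ℂ z).differentiable
  intro w hw
  have hne : (1 : ℂ) - inner ℂ z w ≠ 0 := by
    rw [← norm_pos_iff]
    linarith [sub_norm_le_norm_one_sub_inner (z := z) hw]
  have hnum : DifferentiableAt ℂ
      (fun w : EuclideanSpace ℂ (Fin n) => ((1 : ℂ) - inner ℂ z w) ^ (n + 1)) w :=
    ((differentiableAt_const _).sub (hinner w)).pow _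
  have hq : DifferentiableAt ℂ
      (fun w : EuclideanSpace ℂ (Fin n) => (1 : ℂ) / (1 - inner ℂ z w) ^ (n + 1)) w := by
    simp only [one_div]
    exact hnum.fun_inv (pow_ne_zero (n + 1) hne)
  exact hq.differentiableWithinAt

theorem memLp_bergmanKernelFun {n : ℕ} {z : EuclideanSpace ℂ (Fin n)} (hz : ‖z‖ < 1) :
    MemLp (bergmanKernelFun z) 2 (ballMeasure n) := by
  refine MemLp.of_bound (aestronglyMeasurable_ballMeasure
    (differentiableOn_bergmanKernelFun hz).continuousOn) (1 / (1 - ‖z‖) ^ (n + 1)) ?_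
  filter_upwards [ae_ballMeasure_mem n] with w hw
  have h0 : 0 < 1 - ‖z‖ := by linarith
  rw [bergmanKernelFun, norm_div, norm_one, norm_pow]
  exact one_div_le_one_div_of_le (pow_pos h0 _)
    (pow_le_pow_left₀ h0.le (sub_norm_le_norm_one_sub_inner hw) _)

/-- The Bergman kernel `K_z`, for `z` in the unit ball, as an element of the Bergman space. -/
noncomputable def bergmanKernel {n : ℕ} (z : ball (0 : EuclideanSpace ℂ (Fin n)) 1) :
    bergmanSpace n :=
  have hz : ‖(z : EuclideanSpace ℂ (Fin n))‖ < 1 := mem_ball_zero_iff.1 z.2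
  ⟨(memLp_bergmanKernelFun hz).toLp (bergmanKernelFun (z : EuclideanSpace ℂ (Fin n))),
    bergmanKernelFun z, differentiableOn_bergmanKernelFun hz, MemLp.coeFn_toLp _⟩

/-- The quotient module over `M ∩ 𝔹ₙ`: the closed linear span in the Bergman space of the kernels
`K_z`, `z ∈ M ∩ 𝔹ₙ`. -/
noncomputable def bergmanQuotient {n : ℕ} (M : Set (EuclideanSpace ℂ (Fin n))) :
    Submodule ℂ (bergmanSpace n) :=
  (Submodule.span ℂ {K | ∃ z : ball (0 : EuclideanSpace ℂ (Fin n)) 1,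
    (z : EuclideanSpace ℂ (Fin n)) ∈ M ∧ K = bergmanKernel z}).topologicalClosure

instance instCompleteSpaceBergmanQuotient {n : ℕ} (M : Set (EuclideanSpace ℂ (Fin n))) :
    CompleteSpace (bergmanQuotient M) :=
  (Submodule.isClosed_topologicalClosure _).completeSpace_coe

/-- The orthogonal projection of the Bergman space onto the quotient module over `M ∩ 𝔹ₙ`. -/
noncomputable def bergmanProj {n : ℕ} (M : Set (EuclideanSpace ℂ (Fin n))) :
    bergmanSpace n →L[ℂ] bergmanSpace n :=
  (bergmanQuotient M).starProjection

/-- The angle of two subspaces `H₁`, `H₂` with intersection `H₃`: the arc cosine of the supremum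
of `|⟨u, v⟩| / (‖u‖ ‖v‖)` over nonzero `u ∈ H₁ ⊖ H₃` and `v ∈ H₂ ⊖ H₃`. If there are no such
`u`, `v`, the supremum counts as `0` and the angle is `π / 2`. -/
noncomputable def subspaceAngle {H : Type*} [NormedAddCommGroup H] [InnerProductSpace ℂ H]
    (H₁ H₂ : Submodule ℂ H) : ℝ :=
  Real.arccos (sSup {c : ℝ | ∃ u ∈ H₁ ⊓ (H₁ ⊓ H₂)ᗮ, ∃ v ∈ H₂ ⊓ (H₁ ⊓ H₂)ᗮ,
    u ≠ 0 ∧ v ≠ 0 ∧ c = ‖(inner ℂ u v : ℂ)‖ / (‖u‖ * ‖v‖)})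

/-! Write `P_M` for the projection of `ℂⁿ` onto `M`, and `c` for the cosine of the angle, which is
below `1` by compactness. The proof reduces an operator estimate on the Bergman space to a matrix
inequality in `ℂⁿ`.

Since `⟨z, u⟩ = ⟨P_M z, u⟩` for `u ∈ M`, the projection of `K_z` onto the quotient module over `M`
is `K_{P_M z}` (`starProjection_bergmanQuotient_bergmanKernel`). This uses only the inner products
of kernels, `inner_bergmanKernel`, which come from the moments of the ball; these in turn are read
off from Gaussian integrals.

For `f = ∑ xᵢ K_{zᵢ}` with `zᵢ ∈ M₂`, the squared norms of `f`, `Q₁f`, `Q₃f` are therefore quadratic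
forms of the entrywise image under `(1 - t)^{-(n+1)}` of the Gram matrices of `zᵢ`, `P₁zᵢ`, `P₃zᵢ`.
Splitting off the `M₃` components writes these as `A + G`, `A + K`, `A`, and the definition of the
angle gives `K ≤ c²G`. Schur's product theorem carries this to `(A+K)^k - A^k ≤ c²((A+G)^k - A^k)`
for entrywise powers (`Matrix.PosSemidef.smul_map_pow_sub`), and the Taylor coefficients of the
profile are nonnegative. Hence `‖Q₁f - Q₃f‖ ≤ c‖f‖` on `Q₂`
(`norm_starProjection_sub_le_of_mem_bergmanQuotient`). The norm bound `c²`, the closed sum and the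
intersection all follow from this by Hilbert space geometry. -/

/-! ### Gaussian integrals and the Fock space -/

theorem integrable_exp_mul_norm_mul_gaussian (n : ℕ) (a : ℝ) {b : ℝ} (hb : 0 < b) :
    Integrable (fun w : EuclideanSpace ℂ (Fin n) =>
      Real.exp (a * ‖w‖) * Real.exp (-b * ‖w‖ ^ 2)) := by
  have h := (GaussianFourier.integrable_cexp_neg_mul_sq_norm_add (V := EuclideanSpace ℂ (Fin n))
    (b := ((b / 2 : ℝ) : ℂ)) (by simpa using hb) 0 0).norm
  -- Half of the Gaussian absorbs the exponential: completing the square gives `a t - b t² ≤ a²/(2b)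
  -- - (b/2) t²`.
  refine (h.const_mul (Real.exp (a ^ 2 / (2 * b)))).mono' (by fun_prop) (ae_of_all _ fun w => ?_)
  rw [Real.norm_of_nonneg (by positivity), Complex.norm_exp, ← Real.exp_add, ← Real.exp_add]
  refine Real.exp_le_exp.2 ?_
  have h1 : (-((b / 2 : ℝ) : ℂ) * (‖w‖ : ℂ) ^ 2 + 0 * ((inner ℝ (0 : EuclideanSpace ℂ (Fin n)) w : ℝ) : ℂ)).re
      = -(b / 2) * ‖w‖ ^ 2 := by
    rw [zero_mul, add_zero]
    norm_cast
  rw [h1]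
  have h2 : a ^ 2 / (2 * b) + -(b / 2) * ‖w‖ ^ 2 - (a * ‖w‖ + -b * ‖w‖ ^ 2)
      = (a - b * ‖w‖) ^ 2 / (2 * b) := by
    field_simp
    ring
  have h3 : 0 ≤ (a - b * ‖w‖) ^ 2 / (2 * b) := by positivity
  linarith

/-- Functions of at most exponential growth. -/
def ExpBounded {n : ℕ} (f : EuclideanSpace ℂ (Fin n) → ℂ) : Prop :=
  ∃ C a : ℝ, 0 ≤ a ∧ ∀ w, ‖f w‖ ≤ C * Real.exp (a * ‖w‖)

theorem ExpBounded.mul {n : ℕ} {f g : EuclideanSpace ℂ (Fin n) → ℂ} (hf : ExpBounded f)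
    (hg : ExpBounded g) : ExpBounded fun w => f w * g w := by
  obtain ⟨C, a, ha, hC⟩ := hf
  obtain ⟨D, b, hb, hD⟩ := hg
  refine ⟨C * D, a + b, add_nonneg ha hb, fun w => ?_⟩
  rw [norm_mul, add_mul, Real.exp_add]
  calc ‖f w‖ * ‖g w‖ ≤ (C * Real.exp (a * ‖w‖)) * (D * Real.exp (b * ‖w‖)) :=
        mul_le_mul (hC w) (hD w) (norm_nonneg _) ((norm_nonneg _).trans (hC w))
    _ = _ := by ring

theorem ExpBounded.comp_add {n : ℕ} {f : EuclideanSpace ℂ (Fin n) → ℂ} (hf : ExpBounded f)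
    (v : EuclideanSpace ℂ (Fin n)) : ExpBounded fun w => f (w + v) := by
  obtain ⟨C, a, ha, hC⟩ := hf
  have hC0 : 0 ≤ C := by simpa using (norm_nonneg _).trans (hC 0)
  refine ⟨C * Real.exp (a * ‖v‖), a, ha, fun w => (hC _).trans ?_⟩
  rw [mul_assoc, ← Real.exp_add]
  gcongr
  nlinarith [norm_add_le w v]

theorem expBounded_cexp {n : ℕ} {f : EuclideanSpace ℂ (Fin n) → ℂ} {a : ℝ} (ha : 0 ≤ a)
    (hf : ∀ w, ‖f w‖ ≤ a * ‖w‖) : ExpBounded fun w => Complex.exp (f w) := by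
  refine ⟨1, a, ha, fun w => ?_⟩
  rw [Complex.norm_exp, one_mul]
  exact Real.exp_le_exp.2 ((Complex.re_le_norm _).trans (hf w))

theorem expBounded_pow {n : ℕ} {f : EuclideanSpace ℂ (Fin n) → ℂ} {a : ℝ} (ha : 0 ≤ a)
    (hf : ∀ w, ‖f w‖ ≤ a * ‖w‖) (k : ℕ) : ExpBounded fun w => f w ^ k := by
  refine ⟨k.factorial, a, ha, fun w => ?_⟩
  have h := Real.pow_div_factorial_le_exp (a * ‖w‖) (by positivity) k
  rw [div_le_iff₀ (by positivity)] at h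
  rw [norm_pow]
  calc ‖f w‖ ^ k ≤ (a * ‖w‖) ^ k := pow_le_pow_left₀ (norm_nonneg _) (hf w) k
    _ ≤ _ := h.trans_eq (mul_comm _ _)

theorem ExpBounded.integrable_mul_gaussian {n : ℕ} {f : EuclideanSpace ℂ (Fin n) → ℂ}
    (hf : ExpBounded f) (hfc : Continuous f) :
    Integrable fun w => f w * (Real.exp (-‖w‖ ^ 2) : ℂ) := by
  obtain ⟨C, a, ha, hC⟩ := hf
  refine ((integrable_exp_mul_norm_mul_gaussian n a one_pos).const_mul C).mono'
    (by fun_prop) (ae_of_all _ fun w => ?_)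
  rw [norm_mul, Complex.norm_real, Real.norm_of_nonneg (Real.exp_nonneg _), ← mul_assoc,
    neg_one_mul]
  gcongr
  exact hC w

theorem integral_unit_smul {n : ℕ} {c : ℂ} (hc : ‖c‖ = 1) (h : EuclideanSpace ℂ (Fin n) → ℂ) :
    ∫ w, h (c • w) = ∫ w, h w := by
  let L : EuclideanSpace ℂ (Fin n) →ₗᵢ[ℝ] EuclideanSpace ℂ (Fin n) :=
    { toFun := fun w => c • w
      map_add' := fun x y => smul_add _ x y
      map_smul' := fun c x => smul_comm _ c x
      norm_map' := fun x => by
        change ‖c • x‖ = ‖x‖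
        rw [norm_smul, hc, one_mul] }
  exact (L.toLinearIsometryEquiv rfl).measurePreserving.integral_comp
    (L.toLinearIsometryEquiv rfl).toHomeomorph.measurableEmbedding h

/-- The mean value property with respect to the Gaussian weight. -/
theorem integral_mul_gaussian_eq {n : ℕ} {g : EuclideanSpace ℂ (Fin n) → ℂ}
    (hg : Differentiable ℂ g) (hb : ExpBounded g) :
    ∫ w, g w * (Real.exp (-‖w‖ ^ 2) : ℂ) =
      g 0 * ∫ w : EuclideanSpace ℂ (Fin n), (Real.exp (-‖w‖ ^ 2) : ℂ) := by
  have hgc := hg.continuous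
  obtain ⟨C, a, ha, hC⟩ := hb
  have hcirc : Continuous fun p : ℝ × EuclideanSpace ℂ (Fin n) => circleMap 0 1 p.1 • p.2 :=
    ((continuous_circleMap 0 1).comp continuous_fst).smul continuous_snd
  have hint : Integrable (Function.uncurry
      fun (θ : ℝ) (w : EuclideanSpace ℂ (Fin n)) =>
        g (circleMap 0 1 θ • w) * (Real.exp (-‖w‖ ^ 2) : ℂ))
      ((volume.restrict (Set.Ioc 0 (2 * Real.pi))).prod volume) := by
    refine (((integrable_exp_mul_norm_mul_gaussian n a one_pos).const_mul C).comp_snd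
      (volume.restrict (Set.Ioc 0 (2 * Real.pi)))).mono'
      (Continuous.aestronglyMeasurable ?_) (ae_of_all _ fun p => ?_)
    · exact (hgc.comp hcirc).mul (by fun_prop)
    · simp only [Function.uncurry]
      rw [norm_mul, Complex.norm_real, Real.norm_of_nonneg (Real.exp_nonneg _), ← mul_assoc,
        neg_one_mul]
      gcongr
      refine (hC _).trans_eq ?_
      rw [norm_smul, norm_circleMap_zero, abs_one, one_mul]
  -- In one order of integration, rotation invariance makes the inner integral independent of `θ`;
  -- in the other, the mean value property on each complex line through `0` produces `g 0`.
  have hswap := integral_integral_swap hint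
  have h1 : ∀ θ : ℝ, ∫ w : EuclideanSpace ℂ (Fin n),
      g (circleMap 0 1 θ • w) * (Real.exp (-‖w‖ ^ 2) : ℂ) =
        ∫ w, g w * (Real.exp (-‖w‖ ^ 2) : ℂ) := fun θ => by
    have hc : ‖circleMap 0 1 θ‖ = 1 := by simp
    have h := integral_unit_smul hc fun w => g w * (Real.exp (-‖w‖ ^ 2) : ℂ)
    simpa only [norm_smul, hc, one_mul] using h
  have h2 : ∀ w : EuclideanSpace ℂ (Fin n),
      ∫ θ in Set.Ioc 0 (2 * Real.pi), g (circleMap 0 1 θ • w) * (Real.exp (-‖w‖ ^ 2) : ℂ) =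
        (2 * Real.pi : ℂ) * g 0 * (Real.exp (-‖w‖ ^ 2) : ℂ) := fun w => by
    rw [integral_mul_const]
    congr 1
    have hd : Differentiable ℂ fun t : ℂ => g (t • w) := hg.comp (by fun_prop)
    have hm := (hd.diffContOnCl (s := ball 0 |1|)).circleAverage
    rw [Real.circleAverage_def, zero_smul] at hm
    rw [← hm, intervalIntegral.integral_of_le (by positivity), Complex.real_smul]
    push_cast
    field_simp
  simp only [h1, h2] at hswap
  rw [integral_const, measureReal_restrict_apply_univ, Real.volume_real_Ioc_of_le (by positivity),
    sub_zero, integral_const_mul, Complex.real_smul] at hswap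
  have hpi : (2 * Real.pi : ℂ) ≠ 0 := by exact_mod_cast (by positivity : (2 * Real.pi : ℝ) ≠ 0)
  apply mul_left_cancel₀ hpi
  rw [← mul_assoc, ← hswap]
  push_cast
  ring

/-- The reproducing property of the Fock space. -/
theorem integral_cexp_inner_mul_gaussian {n : ℕ} {f : EuclideanSpace ℂ (Fin n) → ℂ}
    (hf : Differentiable ℂ f) (hb : ExpBounded f) (z : EuclideanSpace ℂ (Fin n)) :
    ∫ w, Complex.exp (inner ℂ w z) * f w * (Real.exp (-‖w‖ ^ 2) : ℂ) =
      f z * ∫ w : EuclideanSpace ℂ (Fin n), (Real.exp (-‖w‖ ^ 2) : ℂ) := by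
  -- After translation by `z` the exponents combine: `⟨w+z, z⟩ - ‖w+z‖² = -⟨z, w⟩ - ‖w‖²`. What
  -- multiplies the Gaussian is then holomorphic in `w`, with value `f z` at `0`.
  rw [← integral_add_right_eq_self _ z]
  have hin : Differentiable ℂ (fun w : EuclideanSpace ℂ (Fin n) => (inner ℂ z w : ℂ)) :=
    (innerSL ℂ z).differentiable
  have h := integral_mul_gaussian_eq (g := fun w => Complex.exp (-inner ℂ z w) * f (w + z))
    ((hin.neg.cexp).mul (hf.comp (by fun_prop)))
    ((expBounded_cexp (norm_nonneg z) fun w => by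
      rw [norm_neg]; exact norm_inner_le_norm z w).mul (hb.comp_add z))
  simp only [inner_zero_right, neg_zero, Complex.exp_zero, one_mul, zero_add] at h
  rw [← h]
  congr 1
  ext w
  rw [mul_right_comm _ (f (w + z)), mul_right_comm _ (f (w + z))]
  congr 1
  rw [Complex.ofReal_exp, Complex.ofReal_exp, ← Complex.exp_add, ← Complex.exp_add]
  congr 1
  have h1 : ((‖w + z‖ : ℂ)) ^ 2 = inner ℂ (w + z) (w + z) := by
    rw [inner_self_eq_norm_sq_to_K]
    rfl
  have h2 : ((‖w‖ : ℂ)) ^ 2 = inner ℂ w w := by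
    rw [inner_self_eq_norm_sq_to_K]
    rfl
  push_cast
  rw [h1, h2]
  simp only [inner_add_left, inner_add_right]
  ring

/-- A suitable rotation of `w` changes the sign of the integrand while preserving the measure. The
radial factor is arbitrary so as to cover both the Gaussian and the indicator of the ball. -/
theorem integral_inner_pow_mul_eq_zero {n : ℕ} (z u : EuclideanSpace ℂ (Fin n)) {j k : ℕ}
    (hjk : j ≠ k) (ρ : ℝ → ℂ) :
    ∫ w, inner ℂ w z ^ j * inner ℂ u w ^ k * ρ ‖w‖ = 0 := by
  -- Chosen so that the rotation `c = e^{iα}` satisfies `conj(c)^j c^k = e^{iα(k-j)} = -1`.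
  set α : ℝ := Real.pi / ((k : ℝ) - j) with hα
  have hkj : ((k : ℂ) - j) ≠ 0 := sub_ne_zero.2 (Nat.cast_injective.ne hjk.symm)
  set c : ℂ := Complex.exp (α * Complex.I) with hc
  have hc1 : ‖c‖ = 1 := Complex.norm_exp_ofReal_mul_I α
  have hcc : (starRingEnd ℂ c) ^ j * c ^ k = -1 := by
    rw [hc, ← Complex.exp_conj, ← Complex.exp_nat_mul, ← Complex.exp_nat_mul, ← Complex.exp_add,
      ← Complex.exp_pi_mul_I]
    congr 1
    simp only [map_mul, Complex.conj_ofReal, Complex.conj_I]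
    have : (Real.pi : ℂ) = α * (k - j) := by
      rw [hα]; push_cast; field_simp
    rw [this]
    ring
  have h := integral_unit_smul hc1 fun w => inner ℂ w z ^ j * inner ℂ u w ^ k * ρ ‖w‖
  simp only [norm_smul, hc1, one_mul, inner_smul_left, inner_smul_right, mul_pow] at h
  have h2 : ∀ w : EuclideanSpace ℂ (Fin n),
      starRingEnd ℂ c ^ j * inner ℂ w z ^ j * (c ^ k * inner ℂ u w ^ k) * ρ ‖w‖ =
        -(inner ℂ w z ^ j * inner ℂ u w ^ k * ρ ‖w‖) := fun w => by
    linear_combination (inner ℂ w z ^ j * inner ℂ u w ^ k * ρ ‖w‖) * hcc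
  simp only [h2, integral_neg] at h
  exact self_eq_neg.1 h.symm

/-- Apply the Fock reproducing formula to `⟨u, ·⟩^k` and expand the exponential: by rotation
invariance only the term of degree `k` survives, and its coefficient `1/k!` accounts for the
factorial. -/
theorem integral_inner_pow_mul_gaussian {n : ℕ} (z u : EuclideanSpace ℂ (Fin n)) (k : ℕ) :
    ∫ w, inner ℂ w z ^ k * inner ℂ u w ^ k * (Real.exp (-‖w‖ ^ 2) : ℂ) =
      k.factorial * inner ℂ u z ^ k *
        ∫ w : EuclideanSpace ℂ (Fin n), (Real.exp (-‖w‖ ^ 2) : ℂ) := by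
  have hin : Differentiable ℂ (fun w : EuclideanSpace ℂ (Fin n) => (inner ℂ u w : ℂ)) :=
    (innerSL ℂ u).differentiable
  have hpb : ExpBounded fun w : EuclideanSpace ℂ (Fin n) => (inner ℂ u w : ℂ) ^ k :=
    expBounded_pow (norm_nonneg u) (fun w => norm_inner_le_norm u w) k
  have hrep := integral_cexp_inner_mul_gaussian (f := fun w => inner ℂ u w ^ k)
    (hin.pow k) hpb z
  have hbd : ExpBounded fun w : EuclideanSpace ℂ (Fin n) =>
      Complex.exp (‖z‖ * ‖w‖) * (inner ℂ u w : ℂ) ^ k :=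
    (expBounded_cexp (norm_nonneg z) fun w => by simp).mul hpb
  have hsum := hasSum_integral_of_dominated_convergence
    (μ := (volume : Measure (EuclideanSpace ℂ (Fin n))))
    (F := fun (j : ℕ) w => (j.factorial : ℂ)⁻¹ * (inner ℂ w z ^ j * inner ℂ u w ^ k *
      (Real.exp (-‖w‖ ^ 2) : ℂ)))
    (f := fun w => Complex.exp (inner ℂ w z) * inner ℂ u w ^ k * (Real.exp (-‖w‖ ^ 2) : ℂ))
    (fun j w => (‖z‖ * ‖w‖) ^ j / j.factorial * ‖inner ℂ u w ^ k * (Real.exp (-‖w‖ ^ 2) : ℂ)‖)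
    (fun j => by fun_prop)
    (fun j => ae_of_all _ fun w => by
      rw [norm_mul, norm_inv, Complex.norm_natCast, mul_assoc, norm_mul, norm_pow, ← mul_assoc,
        inv_mul_eq_div]
      gcongr
      rw [mul_comm]
      exact norm_inner_le_norm w z)
    (ae_of_all _ fun w => (Real.summable_pow_div_factorial _).mul_right _)
    (by
      refine ((hbd.integrable_mul_gaussian (by fun_prop)).norm).congr (ae_of_all _ fun w => ?_)
      simp only
      have hexp : Real.exp (‖z‖ * ‖w‖) = ∑' j : ℕ, (‖z‖ * ‖w‖) ^ j / j.factorial := by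
        rw [Real.exp_eq_exp_ℝ, NormedSpace.exp_eq_tsum_div]
      rw [tsum_mul_right, mul_assoc, norm_mul, ← hexp, Complex.norm_exp]
      norm_cast)
    (ae_of_all _ fun w => by
      have h : HasSum (fun j : ℕ => (inner ℂ w z : ℂ) ^ j / j.factorial)
          (Complex.exp (inner ℂ w z)) := by
        rw [Complex.exp_eq_exp_ℂ]
        exact NormedSpace.expSeries_div_hasSum_exp _
      convert! (h.mul_right (inner ℂ u w ^ k * (Real.exp (-‖w‖ ^ 2) : ℂ))) using 1
      · ext j; ring
      · ring)
  have h1 := hsum.unique (hasSum_single k fun j hj => by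
    rw [integral_const_mul, integral_inner_pow_mul_eq_zero z u hj
      (fun r => (Real.exp (-r ^ 2) : ℂ)), mul_zero])
  rw [hrep, integral_const_mul] at h1
  have hk : (k.factorial : ℂ) ≠ 0 := by exact_mod_cast k.factorial_ne_zero
  rw [mul_assoc, h1, mul_inv_cancel_left₀ hk]

/-! ### From the Gaussian weight to moments of the ball -/

/-- Scaling by `√s` contributes `s^n` from the real dimension `2n` and `s^k` from the homogeneity of
degree `2k`. -/
theorem setIntegral_ball_sqrt {n k : ℕ} {h : EuclideanSpace ℂ (Fin n) → ℂ}
    (hh : ∀ (t : ℝ) w, h (t • w) = (t : ℂ) ^ (2 * k) * h w) {s : ℝ} (hs : 0 < s) :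
    ∫ w in ball 0 (√s), h w = (s : ℂ) ^ (n + k) * ∫ w in ball 0 1, h w := by
  have hr : 0 < √s := Real.sqrt_pos.2 hs
  have h1 := Measure.setIntegral_comp_smul_of_pos
    (volume : Measure (EuclideanSpace ℂ (Fin n))) h (ball 0 1) hr
  rw [smul_unitBall_of_pos hr] at h1
  have hfr : Module.finrank ℝ (EuclideanSpace ℂ (Fin n)) = 2 * n := by
    rw [finrank_real_of_complex, finrank_euclideanSpace_fin]
  simp only [hh, integral_const_mul, hfr] at h1
  rw [Complex.real_smul] at h1
  have h2 : ∀ m : ℕ, ((√s : ℝ) : ℂ) ^ (2 * m) = (s : ℂ) ^ m := fun m => by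
    rw [pow_mul]
    congr 1
    exact_mod_cast Real.sq_sqrt hs.le
  rw [Complex.ofReal_inv, Complex.ofReal_pow, h2, h2, eq_inv_mul_iff_mul_eq₀
    (pow_ne_zero _ (by exact_mod_cast hs.ne'))] at h1
  rw [← h1, pow_add, mul_assoc]

/-- Polar integration of a homogeneous function against the Gaussian weight. -/
theorem integral_mul_gaussian_eq_setIntegral_ball {n k : ℕ} {h : EuclideanSpace ℂ (Fin n) → ℂ}
    (hc : Continuous h) (hb : ExpBounded h)
    (hh : ∀ (t : ℝ) w, h (t • w) = (t : ℂ) ^ (2 * k) * h w) :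
    ∫ w, h w * (Real.exp (-‖w‖ ^ 2) : ℂ) = (n + k).factorial * ∫ w in ball 0 1, h w := by
  obtain ⟨C, a, ha, hC⟩ := hb
  -- Layer-cake formula: `e^{-‖w‖²}` is the integral of `e^{-s}` over `s > ‖w‖²`. Swapping the
  -- integrals leaves balls of radius `√s`, and then the Gamma integral of `e^{-s} s^{n+k}`.
  set S : Set (EuclideanSpace ℂ (Fin n) × ℝ) := {p | ‖p.1‖ ^ 2 < p.2} with hS
  have hSm : MeasurableSet S :=
    (isOpen_lt (by fun_prop) (by fun_prop)).measurableSet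
  set F : EuclideanSpace ℂ (Fin n) × ℝ → ℂ :=
    S.indicator fun p => h p.1 * (Real.exp (-p.2) : ℂ) with hF
  have hint : Integrable F (volume.prod (volume.restrict (Set.Ioi 0))) := by
    have h1 : Integrable (fun s : ℝ => Real.exp (-(1 / 2) * s)) (volume.restrict (Set.Ioi 0)) :=
      exp_neg_integrableOn_Ioi 0 (by norm_num)
    refine (((integrable_exp_mul_norm_mul_gaussian n a (b := 1 / 2) (by norm_num)).const_mul
      C).mul_prod h1).mono'
      (AEStronglyMeasurable.indicator (Continuous.aestronglyMeasurable (by fun_prop)) hSm)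
      (ae_of_all _ fun p => ?_)
    have hC0 : 0 ≤ C := by simpa using (norm_nonneg _).trans (hC 0)
    by_cases hp : p ∈ S
    · rw [hF, Set.indicator_of_mem hp, norm_mul, Complex.norm_real,
        Real.norm_of_nonneg (Real.exp_nonneg _), ← mul_assoc, mul_assoc, ← Real.exp_add]
      have hp' : ‖p.1‖ ^ 2 < p.2 := hp
      refine mul_le_mul (hC _) (Real.exp_le_exp.2 (by linarith)) (by positivity) (by positivity)
    · rw [hF, Set.indicator_of_notMem hp, norm_zero]
      positivity
  have hswap := integral_integral_swap (f := fun w s => F (w, s)) hint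
  have h1 : ∀ w : EuclideanSpace ℂ (Fin n), ∫ s in Set.Ioi 0, F (w, s) =
      h w * (Real.exp (-‖w‖ ^ 2) : ℂ) := fun w => by
    have : ∀ s, F (w, s) = (Set.Ioi (‖w‖ ^ 2)).indicator
        (fun s => h w * (Real.exp (-s) : ℂ)) s := fun s => rfl
    simp only [this]
    rw [setIntegral_indicator measurableSet_Ioi, Set.Ioi_inter_Ioi, sup_eq_right.2 (by positivity),
      integral_const_mul, integral_complex_ofReal, integral_exp_neg_Ioi]
  have h2 : ∀ s ∈ Set.Ioi (0 : ℝ), ∫ w, F (w, s) =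
      ((Real.exp (-s) * s ^ (n + k) : ℝ) : ℂ) * ∫ w in ball 0 1, h w := fun s hs => by
    have : ∀ w, F (w, s) = (ball 0 (√s)).indicator
        (fun w => h w * (Real.exp (-s) : ℂ)) w := fun w => by
      have hiff : (w, s) ∈ S ↔ w ∈ ball 0 (√s) := by
        rw [mem_ball_zero_iff, Real.lt_sqrt (norm_nonneg _)]
        rfl
      by_cases hw : (w, s) ∈ S
      · rw [hF, Set.indicator_of_mem hw, Set.indicator_of_mem (hiff.1 hw)]
      · rw [hF, Set.indicator_of_notMem hw, Set.indicator_of_notMem (hw ∘ hiff.2)]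
    simp only [this]
    rw [integral_indicator measurableSet_ball, integral_mul_const,
      setIntegral_ball_sqrt hh (Set.mem_Ioi.1 hs)]
    push_cast
    ring
  simp only [h1] at hswap
  rw [hswap, setIntegral_congr_fun measurableSet_Ioi h2, integral_mul_const,
    integral_complex_ofReal]
  congr 1
  have hG := Real.Gamma_eq_integral (s := ((n + k : ℕ) : ℝ) + 1) (by positivity)
  rw [Real.Gamma_nat_eq_factorial] at hG
  rw [← Complex.ofReal_natCast, hG]
  congr 1
  refine setIntegral_congr_fun measurableSet_Ioi fun s hs => ?_
  simp only [add_sub_cancel_right, Real.rpow_natCast]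

theorem integral_ballMeasure {n : ℕ} (h : EuclideanSpace ℂ (Fin n) → ℂ) :
    ∫ w, h w ∂ballMeasure n =
      ((volume.real (ball (0 : EuclideanSpace ℂ (Fin n)) 1) : ℝ) : ℂ)⁻¹ *
        ∫ w in ball 0 1, h w := by
  rw [ballMeasure, integral_smul_measure, ENNReal.toReal_inv, Complex.real_smul,
    Complex.ofReal_inv]
  rfl

theorem integral_inner_pow_mul_inner_pow_ballMeasure {n : ℕ} (z u : EuclideanSpace ℂ (Fin n))
    (j k : ℕ) :
    ∫ w, inner ℂ w z ^ j * inner ℂ u w ^ k ∂ballMeasure n =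
      if j = k then ((k + n).choose n : ℂ)⁻¹ * inner ℂ u z ^ k else 0 := by
  rw [integral_ballMeasure]
  have hV : (volume.real (ball (0 : EuclideanSpace ℂ (Fin n)) 1) : ℂ) ≠ 0 := by
    rw [Complex.ofReal_ne_zero, measureReal_def]
    exact ENNReal.toReal_ne_zero.2 ⟨volume_ball_ne_zero _ one_pos, volume_ball_ne_top _ _⟩
  split_ifs with hjk
  · subst hjk
    have hin1 : ∀ w : EuclideanSpace ℂ (Fin n), ‖(inner ℂ w z : ℂ)‖ ≤ ‖z‖ * ‖w‖ := fun w => by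
      rw [mul_comm]; exact norm_inner_le_norm w z
    have h1 := integral_mul_gaussian_eq_setIntegral_ball (n := n) (k := j)
      (h := fun w => inner ℂ w z ^ j * inner ℂ u w ^ j) (by fun_prop)
      ((expBounded_pow (norm_nonneg z) hin1 j).mul
        (expBounded_pow (norm_nonneg u) (fun w => norm_inner_le_norm u w) j))
      (fun t w => by
        simp only [inner_smul_left_eq_smul, inner_smul_right_eq_smul, Complex.real_smul]
        ring)
    -- The constant function evaluates the total Gaussian mass as `n!` times the volume of the ball,
    -- which normalizes the moment formula.
    have h0 := integral_mul_gaussian_eq_setIntegral_ball (n := n) (k := 0)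
      (h := fun _ => 1) continuous_const ⟨1, 0, le_rfl, fun w => by simp⟩ (fun t w => by simp)
    rw [integral_inner_pow_mul_gaussian] at h1
    simp only [one_mul, add_zero, integral_const, measureReal_restrict_apply_univ,
      Complex.real_smul, mul_one] at h0
    rw [h0] at h1
    have hch : ((j + n).choose n : ℂ) * n.factorial * j.factorial = (n + j).factorial := by
      have := Nat.add_choose_mul_factorial_mul_factorial n j
      rw [← Nat.choose_symm_add, Nat.add_comm n j] at this
      rw [Nat.add_comm n j]
      exact_mod_cast this
    have hf : ((n + j).factorial : ℂ) ≠ 0 := by exact_mod_cast (n + j).factorial_ne_zero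
    have hcz : ((j + n).choose n : ℂ) ≠ 0 := by
      exact_mod_cast (Nat.choose_pos (Nat.le_add_left n j)).ne'
    apply mul_left_cancel₀ hf
    rw [mul_left_comm, ← h1, ← hch]
    field_simp
  · rw [← integral_indicator measurableSet_ball]
    have h := integral_inner_pow_mul_eq_zero z u hjk fun r => if r < 1 then 1 else 0
    rw [← mul_zero (_ : ℂ)⁻¹, ← h]
    congr 2
    ext w
    by_cases hw : w ∈ ball (0 : EuclideanSpace ℂ (Fin n)) 1
    · rw [Set.indicator_of_mem hw, if_pos (mem_ball_zero_iff.1 hw), mul_one]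
    · rw [Set.indicator_of_notMem hw, if_neg (fun h => hw (mem_ball_zero_iff.2 h)), mul_zero]

/-! ### Inner products of Bergman kernels -/

theorem hasSum_bergmanKernelFun {n : ℕ} {u w : EuclideanSpace ℂ (Fin n)} (hu : ‖u‖ < 1)
    (hw : w ∈ ball (0 : EuclideanSpace ℂ (Fin n)) 1) :
    HasSum (fun k : ℕ => ((k + n).choose n : ℂ) * inner ℂ u w ^ k) (bergmanKernelFun u w) :=
  hasSum_choose_mul_geometric_of_norm_lt_one n ((norm_inner_le_of_mem_ball hw).trans_lt hu)

theorem hasSum_integral_mul_bergmanKernelFun {n : ℕ} {u : EuclideanSpace ℂ (Fin n)}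
    (hu : ‖u‖ < 1) {g : EuclideanSpace ℂ (Fin n) → ℂ}
    (hg : AEStronglyMeasurable g (ballMeasure n)) {D : ℝ} (hD : ∀ᵐ w ∂ballMeasure n, ‖g w‖ ≤ D) :
    HasSum (fun k : ℕ => ((k + n).choose n : ℂ) * ∫ w, g w * inner ℂ u w ^ k ∂ballMeasure n)
      (∫ w, g w * bergmanKernelFun u w ∂ballMeasure n) := by
  have hu' : ‖(‖u‖ : ℝ)‖ < 1 := by rwa [norm_norm]
  have hs := summable_choose_mul_geometric_of_norm_lt_one n hu'
  have h := hasSum_integral_of_dominated_convergence (μ := ballMeasure n)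
    (F := fun (k : ℕ) w => ((k + n).choose n : ℂ) * (g w * inner ℂ u w ^ k))
    (f := fun w => g w * bergmanKernelFun u w)
    (fun k _ => D * (((k + n).choose n : ℝ) * ‖u‖ ^ k))
    (fun k => (hg.mul (by fun_prop)).const_mul _)
    (fun k => by
      filter_upwards [hD, ae_ballMeasure_mem n] with w h1 h2
      rw [norm_mul, norm_mul, norm_pow, Complex.norm_natCast, mul_left_comm]
      have h3 := norm_inner_le_of_mem_ball (z := u) h2
      have h4 := (norm_nonneg _).trans h1
      gcongr)
    (ae_of_all _ fun w => hs.mul_left D) (integrable_const _)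
    (by
      filter_upwards [ae_ballMeasure_mem n] with w hw
      convert! (hasSum_bergmanKernelFun hu hw).mul_left (g w) using 2
      ring)
  simpa only [integral_const_mul] using h

/-- Integrating the kernel series term by term, orthogonality leaves degree `j`, where the binomial
coefficient of the kernel cancels the one in the moment. -/
theorem integral_inner_pow_mul_bergmanKernelFun {n : ℕ} {z u : EuclideanSpace ℂ (Fin n)}
    (hu : ‖u‖ < 1) (hz : ‖z‖ < 1) (j : ℕ) :
    ∫ w, inner ℂ w z ^ j * bergmanKernelFun u w ∂ballMeasure n = inner ℂ u z ^ j := by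
  have h := hasSum_integral_mul_bergmanKernelFun hu (g := fun w => inner ℂ w z ^ j) (D := 1)
    (by fun_prop) (by
      filter_upwards [ae_ballMeasure_mem n] with w hw
      rw [norm_pow, norm_inner_symm]
      exact pow_le_one₀ (norm_nonneg _) ((norm_inner_le_of_mem_ball hw).trans hz.le))
  refine (h.unique (hasSum_single j fun k hk => ?_)).trans ?_
  · rw [integral_inner_pow_mul_inner_pow_ballMeasure, if_neg hk.symm, mul_zero]
  · rw [integral_inner_pow_mul_inner_pow_ballMeasure, if_pos rfl]
    have hcz : ((j + n).choose n : ℂ) ≠ 0 := by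
      exact_mod_cast (Nat.choose_pos (Nat.le_add_left n j)).ne'
    rw [mul_inv_cancel_left₀ hcz]

/-- The reproducing property on kernels. -/
theorem inner_bergmanKernel {n : ℕ} (z u : ball (0 : EuclideanSpace ℂ (Fin n)) 1) :
    inner ℂ (bergmanKernel z) (bergmanKernel u) =
      bergmanKernelFun (u : EuclideanSpace ℂ (Fin n)) z := by
  have hz : ‖(z : EuclideanSpace ℂ (Fin n))‖ < 1 := mem_ball_zero_iff.1 z.2
  have hu : ‖(u : EuclideanSpace ℂ (Fin n))‖ < 1 := mem_ball_zero_iff.1 u.2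
  have h1 : inner ℂ (bergmanKernel z) (bergmanKernel u) =
      ∫ w, starRingEnd ℂ (bergmanKernelFun (z : EuclideanSpace ℂ (Fin n)) w) *
        bergmanKernelFun (u : EuclideanSpace ℂ (Fin n)) w ∂ballMeasure n := by
    rw [Submodule.coe_inner, L2.inner_def]
    refine integral_congr_ae ?_
    filter_upwards [(memLp_bergmanKernelFun hz).coeFn_toLp,
      (memLp_bergmanKernelFun hu).coeFn_toLp] with w h2 h3
    rw [RCLike.inner_apply', ← h2, ← h3]
    rfl
  have hswap : ∀ f g : EuclideanSpace ℂ (Fin n) → ℂ,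
      ∫ w, starRingEnd ℂ (f w) * g w ∂ballMeasure n =
        starRingEnd ℂ (∫ w, starRingEnd ℂ (g w) * f w ∂ballMeasure n) := fun f g => by
    rw [← integral_conj]
    simp only [map_mul, Complex.conj_conj, mul_comm]
  have hm := (differentiableOn_bergmanKernelFun hu).continuousOn
  have hK : ∀ᵐ w ∂ballMeasure n, ‖starRingEnd ℂ (bergmanKernelFun
      (u : EuclideanSpace ℂ (Fin n)) w)‖ ≤ 1 / (1 - ‖(u : EuclideanSpace ℂ (Fin n))‖) ^ (n + 1) := by
    filter_upwards [ae_ballMeasure_mem n] with w hw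
    have h0 : 0 < 1 - ‖(u : EuclideanSpace ℂ (Fin n))‖ := by linarith
    rw [RCLike.norm_conj, bergmanKernelFun, norm_div, norm_one, norm_pow]
    exact one_div_le_one_div_of_le (pow_pos h0 _)
      (pow_le_pow_left₀ h0.le (sub_norm_le_norm_one_sub_inner hw) _)
  -- Only `K_z` is expanded; `K_u` stays whole and reproduces each power of `⟨z, w⟩`, up to
  -- conjugation. The resulting series sums to the kernel again.
  have h := hasSum_integral_mul_bergmanKernelFun hz
    (Complex.continuous_conj.comp_aestronglyMeasurable (aestronglyMeasurable_ballMeasure hm)) hK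
  have h2 : ∀ k : ℕ, ∫ w, starRingEnd ℂ (bergmanKernelFun (u : EuclideanSpace ℂ (Fin n)) w) *
      inner ℂ (z : EuclideanSpace ℂ (Fin n)) w ^ k ∂ballMeasure n =
        inner ℂ (z : EuclideanSpace ℂ (Fin n)) u ^ k := fun k => by
    rw [hswap]
    simp only [map_pow, inner_conj_symm]
    rw [integral_inner_pow_mul_bergmanKernelFun hu hz, map_pow, inner_conj_symm]
  simp only [h2] at h
  rw [h1, hswap, h.unique (hasSum_bergmanKernelFun hz u.2)]
  simp [bergmanKernelFun]

/-! ### Projections and closed sums in Hilbert space -/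

section Hilbert

variable {H : Type*} [NormedAddCommGroup H] [InnerProductSpace ℂ H]

theorem starProjection_apply_starProjection_of_le {U V : Submodule ℂ H}
    [U.HasOrthogonalProjection] [V.HasOrthogonalProjection] (h : U ≤ V) (x : H) :
    U.starProjection (V.starProjection x) = U.starProjection x :=
  DFunLike.congr_fun (Submodule.starProjection_comp_starProjection_of_le h) x

theorem norm_inner_self_eq_mul_norm (x : H) : ‖(inner ℂ x x : ℂ)‖ = ‖x‖ * ‖x‖ := by
  rw [inner_self_eq_norm_sq_to_K, norm_pow, RCLike.norm_ofReal, abs_norm, sq]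

theorem norm_sub_starProjection_sq (W : Submodule ℂ H) [W.HasOrthogonalProjection] (x : H) :
    ‖x - W.starProjection x‖ ^ 2 = ‖x‖ ^ 2 - ‖W.starProjection x‖ ^ 2 := by
  have h := W.norm_sq_eq_add_norm_sq_starProjection x
  rw [Submodule.starProjection_orthogonal_val] at h
  linarith

/-- As `U - W` is itself a projection (names standing for projections), `VUV - W = V(U - W)V = T*T`
with `T = (U - W)V`, and `‖T‖ ≤ c`. The second factor `c` comes from the adjoint, by testing `p =
Vg` against itself. -/
theorem norm_starProjection_comp_sub_le {U V W : Submodule ℂ H} [U.HasOrthogonalProjection]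
    [V.HasOrthogonalProjection] [W.HasOrthogonalProjection] (hWU : W ≤ U) (hWV : W ≤ V)
    {c : ℝ} (hc : 0 ≤ c)
    (h : ∀ f ∈ V, ‖U.starProjection f - W.starProjection f‖ ≤ c * ‖f‖) :
    ‖V.starProjection ∘L U.starProjection ∘L V.starProjection - W.starProjection‖ ≤ c ^ 2 := by
  refine ContinuousLinearMap.opNorm_le_bound _ (sq_nonneg c) fun x => ?_
  set f := V.starProjection x with hf
  set g := U.starProjection f - W.starProjection f with hg
  have hfV : f ∈ V := Submodule.starProjection_apply_mem _ _
  have hWf : W.starProjection f = W.starProjection x :=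
    starProjection_apply_starProjection_of_le hWV x
  have hmem : W.starProjection x ∈ V := hWV (Submodule.starProjection_apply_mem _ _)
  have h1 : (V.starProjection ∘L U.starProjection ∘L V.starProjection - W.starProjection) x =
      V.starProjection g := by
    simp only [sub_apply, ContinuousLinearMap.comp_apply]
    rw [hg, map_sub, hWf, Submodule.starProjection_eq_self_iff.2 hmem]
  have hgg : U.starProjection g - W.starProjection g = g := by
    have hU : U.starProjection g = g := Submodule.starProjection_eq_self_iff.2
      (U.sub_mem (Submodule.starProjection_apply_mem _ _)
        (hWU (Submodule.starProjection_apply_mem _ _)))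
    have hW : W.starProjection g = 0 := by
      rw [hg, map_sub, starProjection_apply_starProjection_of_le hWU,
        starProjection_apply_starProjection_of_le le_rfl, sub_self]
    rw [hU, hW, sub_zero]
  have hgn : ‖g‖ ≤ c * ‖f‖ := h f hfV
  have hfn : ‖f‖ ≤ ‖x‖ := V.norm_starProjection_apply_le x
  set p := V.starProjection g with hp
  have hpV : p ∈ V := Submodule.starProjection_apply_mem _ _
  have hinner : (inner ℂ p p : ℂ) =
      inner ℂ (U.starProjection p - W.starProjection p) g := by
    rw [inner_sub_left, Submodule.inner_starProjection_left_eq_right U,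
      Submodule.inner_starProjection_left_eq_right W, ← inner_sub_right, hgg, hp,
      Submodule.inner_starProjection_left_eq_right, Submodule.inner_starProjection_left_eq_right,
      starProjection_apply_starProjection_of_le le_rfl]
  have hpsq : ‖p‖ * ‖p‖ ≤ c * ‖p‖ * ‖g‖ := by
    rw [← norm_inner_self_eq_mul_norm, hinner]
    exact (norm_inner_le_norm _ _).trans (mul_le_mul_of_nonneg_right (h p hpV) (norm_nonneg _))
  have hpn : ‖p‖ ≤ c * ‖g‖ := by
    rcases (norm_nonneg p).eq_or_lt with h0 | h0
    · rw [← h0]; positivity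
    · exact le_of_mul_le_mul_right (by linarith) h0
  rw [h1]
  calc ‖p‖ ≤ c * ‖g‖ := hpn
    _ ≤ c * (c * ‖x‖) := by gcongr; exact hgn.trans (by gcongr)
    _ = c ^ 2 * ‖x‖ := by ring

/-- For `f ∈ U ⊓ V`, the vector `f - Wf` is fixed by the projection onto `U` and killed by that onto
`W`, so its norm is at most `c < 1` times itself. -/
theorem inf_eq_of_norm_starProjection_sub_le {U V W : Submodule ℂ H} [U.HasOrthogonalProjection]
    [W.HasOrthogonalProjection] (hWU : W ≤ U) (hWV : W ≤ V) {c : ℝ} (hc : c < 1)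
    (h : ∀ f ∈ V, ‖U.starProjection f - W.starProjection f‖ ≤ c * ‖f‖) : U ⊓ V = W := by
  refine le_antisymm (fun f hf => ?_) (le_inf hWU hWV)
  have hW := W.starProjection_apply_mem f
  have h1 := h _ (V.sub_mem hf.2 (hWV hW))
  rw [Submodule.starProjection_eq_self_iff.2 (U.sub_mem hf.1 (hWU hW)), map_sub,
    starProjection_apply_starProjection_of_le le_rfl, sub_self, sub_zero] at h1
  have h2 : ‖f - W.starProjection f‖ = 0 := by nlinarith [norm_nonneg (f - W.starProjection f)]
  rw [norm_eq_zero, sub_eq_zero] at h2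
  rw [h2]
  exact hW

/-- On `V ⊖ W` the operator `T = 1 - U` is bounded below by `1 - c`, so its image there is closed;
`U + V` is the preimage of that image under `T`, since `T` kills `U`, hence `W`. -/
theorem isClosed_sup_of_norm_starProjection_sub_le [CompleteSpace H] {U V W : Submodule ℂ H}
    [U.HasOrthogonalProjection] [W.HasOrthogonalProjection] (hV : IsClosed (V : Set H))
    (hWU : W ≤ U) (hWV : W ≤ V) {c : ℝ} (hc : c < 1)
    (h : ∀ f ∈ V, ‖U.starProjection f - W.starProjection f‖ ≤ c * ‖f‖) :
    IsClosed ((U ⊔ V : Submodule ℂ H) : Set H) := by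
  set X : Submodule ℂ H := V ⊓ Wᗮ with hX
  set T : H →L[ℂ] H := ContinuousLinearMap.id ℂ H - U.starProjection with hT
  have hTx : ∀ x, T x = x - U.starProjection x := fun x => rfl
  have hXc : IsClosed (X : Set H) := hV.inter W.isClosed_orthogonal
  have : CompleteSpace X := hXc.completeSpace_coe
  have hanti : ∀ v ∈ X, (1 - c) * ‖v‖ ≤ ‖T v‖ := fun v hv => by
    have h1 := h v hv.1
    rw [(Submodule.starProjection_apply_eq_zero_iff W).2 hv.2, sub_zero] at h1
    have h2 := norm_sub_norm_le v (U.starProjection v)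
    rw [hTx]
    linarith
  have hc' : 0 < 1 - c := by linarith
  have hal : AntilipschitzWith (Real.toNNReal (1 - c)⁻¹) (T ∘L X.subtypeL) := by
    refine ContinuousLinearMap.antilipschitz_of_bound _ fun v => ?_
    rw [Real.coe_toNNReal _ (by positivity), inv_mul_eq_div, le_div_iff₀ hc', mul_comm]
    exact hanti v v.2
  have hcl : IsClosed (Set.range (T ∘L X.subtypeL)) :=
    hal.isClosed_range (T ∘L X.subtypeL).uniformContinuous
  have hpre : ((U ⊔ V : Submodule ℂ H) : Set H) = T ⁻¹' Set.range (T ∘L X.subtypeL) := by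
    ext x
    simp only [SetLike.mem_coe, Set.mem_preimage, Set.mem_range]
    constructor
    · intro hx
      obtain ⟨u, hu, v, hv, rfl⟩ := Submodule.mem_sup.1 hx
      refine ⟨⟨v - W.starProjection v, V.sub_mem hv (hWV (W.starProjection_apply_mem v)),
        W.sub_starProjection_mem_orthogonal v⟩, ?_⟩
      have hz : ∀ y ∈ U, T y = 0 := fun y hy => by
        rw [hTx, Submodule.starProjection_eq_self_iff.2 hy, sub_self]
      change T (v - W.starProjection v) = T (u + v)
      rw [map_sub, map_add, hz u hu, hz _ (hWU (W.starProjection_apply_mem v)), zero_add, sub_zero]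
    · rintro ⟨v, hv⟩
      have hv' : T v = T x := hv
      rw [hTx, hTx] at hv'
      have hx : x = U.starProjection (x - v) + v := by
        rw [map_sub, sub_add_eq_add_sub, add_sub_assoc, hv']
        abel
      rw [hx]
      exact Submodule.add_mem_sup (U.starProjection_apply_mem _) v.2.1
  rw [hpre]
  exact hcl.preimage T.continuous

/-! ### The angle of two subspaces -/

theorem norm_inner_div_le_one (u v : H) : ‖(inner ℂ u v : ℂ)‖ / (‖u‖ * ‖v‖) ≤ 1 :=
  div_le_one_of_le₀ (norm_inner_le_norm u v) (by positivity)

theorem cos_subspaceAngle (M₁ M₂ : Submodule ℂ H) :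
    Real.cos (subspaceAngle M₁ M₂) =
      sSup {c : ℝ | ∃ u ∈ M₁ ⊓ (M₁ ⊓ M₂)ᗮ, ∃ v ∈ M₂ ⊓ (M₁ ⊓ M₂)ᗮ,
        u ≠ 0 ∧ v ≠ 0 ∧ c = ‖(inner ℂ u v : ℂ)‖ / (‖u‖ * ‖v‖)} := by
  refine Real.cos_arccos ?_ ?_
  · refine le_trans (by norm_num) (Real.sSup_nonneg ?_)
    rintro _ ⟨u, -, v, -, -, -, rfl⟩
    positivity
  · refine Real.sSup_le ?_ zero_le_one
    rintro _ ⟨u, -, v, -, -, -, rfl⟩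
    exact norm_inner_div_le_one u v

theorem cos_subspaceAngle_nonneg (M₁ M₂ : Submodule ℂ H) :
    0 ≤ Real.cos (subspaceAngle M₁ M₂) := by
  rw [cos_subspaceAngle]
  refine Real.sSup_nonneg ?_
  rintro _ ⟨u, -, v, -, -, -, rfl⟩
  positivity

theorem norm_inner_le_cos_subspaceAngle {M₁ M₂ : Submodule ℂ H} {u v : H}
    (hu : u ∈ M₁ ⊓ (M₁ ⊓ M₂)ᗮ) (hv : v ∈ M₂ ⊓ (M₁ ⊓ M₂)ᗮ) :
    ‖(inner ℂ u v : ℂ)‖ ≤ Real.cos (subspaceAngle M₁ M₂) * (‖u‖ * ‖v‖) := by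
  by_cases hu0 : u = 0
  · simp [hu0]
  by_cases hv0 : v = 0
  · simp [hv0]
  have hpos : 0 < ‖u‖ * ‖v‖ := mul_pos (norm_pos_iff.2 hu0) (norm_pos_iff.2 hv0)
  rw [← div_le_iff₀ hpos, cos_subspaceAngle]
  refine le_csSup ⟨1, ?_⟩ ⟨u, hu, v, hv, hu0, hv0, rfl⟩
  rintro _ ⟨u, -, v, -, -, -, rfl⟩
  exact norm_inner_div_le_one u v

/-- By compactness of the unit spheres a nonempty supremum is attained. Were it `1`, equality in
Cauchy–Schwarz would make `v` a multiple of `u`, hence an element of `M₁ ⊓ M₂` orthogonal to `M₁ ⊓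
M₂`, so zero. -/
theorem cos_subspaceAngle_lt_one [FiniteDimensional ℂ H] (M₁ M₂ : Submodule ℂ H) :
    Real.cos (subspaceAngle M₁ M₂) < 1 := by
  have : ProperSpace H := FiniteDimensional.proper ℂ H
  rw [cos_subspaceAngle]
  set S := {c : ℝ | ∃ u ∈ M₁ ⊓ (M₁ ⊓ M₂)ᗮ, ∃ v ∈ M₂ ⊓ (M₁ ⊓ M₂)ᗮ,
        u ≠ 0 ∧ v ≠ 0 ∧ c = ‖(inner ℂ u v : ℂ)‖ / (‖u‖ * ‖v‖)} with hS
  rcases S.eq_empty_or_nonempty with hem | hne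
  · rw [hem, Real.sSup_empty]
    exact zero_lt_one
  set N₁ : Submodule ℂ H := M₁ ⊓ (M₁ ⊓ M₂)ᗮ
  set N₂ : Submodule ℂ H := M₂ ⊓ (M₁ ⊓ M₂)ᗮ
  have hK : ∀ N : Submodule ℂ H, IsCompact ((N : Set H) ∩ sphere 0 1) := fun N =>
    (isCompact_sphere 0 1).inter_left N.closed_of_finiteDimensional
  have himg : S = (fun p : H × H => ‖(inner ℂ p.1 p.2 : ℂ)‖) ''
      (((N₁ : Set H) ∩ sphere 0 1) ×ˢ ((N₂ : Set H) ∩ sphere 0 1)) := by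
    ext c
    constructor
    · rintro ⟨u, hu, v, hv, hu0, hv0, rfl⟩
      refine ⟨(((‖u‖⁻¹ : ℝ) : ℂ) • u, ((‖v‖⁻¹ : ℝ) : ℂ) • v),
        ⟨⟨N₁.smul_mem _ hu, ?_⟩, ⟨N₂.smul_mem _ hv, ?_⟩⟩, ?_⟩
      · rw [mem_sphere_zero_iff_norm, norm_smul, Complex.norm_real, norm_inv, norm_norm,
          inv_mul_cancel₀ (norm_ne_zero_iff.2 hu0)]
      · rw [mem_sphere_zero_iff_norm, norm_smul, Complex.norm_real, norm_inv, norm_norm,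
          inv_mul_cancel₀ (norm_ne_zero_iff.2 hv0)]
      · simp only [inner_smul_left, inner_smul_right, norm_mul, RCLike.norm_conj,
          Complex.norm_real, norm_inv, norm_norm]
        field_simp
    · rintro ⟨⟨u, v⟩, ⟨⟨hu, hu1⟩, ⟨hv, hv1⟩⟩, rfl⟩
      have hu1' : ‖u‖ = 1 := mem_sphere_zero_iff_norm.1 hu1
      have hv1' : ‖v‖ = 1 := mem_sphere_zero_iff_norm.1 hv1
      refine ⟨u, hu, v, hv, norm_ne_zero_iff.1 (by rw [hu1']; norm_num),
        norm_ne_zero_iff.1 (by rw [hv1']; norm_num), ?_⟩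
      simp [hu1', hv1']
  have hSc : IsCompact S := by
    rw [himg]
    exact ((hK N₁).prod (hK N₂)).image (by fun_prop)
  obtain ⟨u, hu, v, hv, hu0, hv0, huv⟩ := hSc.sSup_mem hne
  rw [huv]
  refine lt_of_le_of_ne (norm_inner_div_le_one u v) fun h1 => hv0 ?_
  obtain ⟨r, hr, hvr⟩ := ((norm_inner_div_norm_mul_norm_eq_one_iff (𝕜 := ℂ) u v).1 (by
    simpa using h1)).2
  have hmem : v ∈ M₁ ⊓ M₂ := ⟨hvr ▸ M₁.smul_mem r hu.1, hv.1⟩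
  exact inner_self_eq_zero.1 (hv.2 _ hmem)

/-- The projection `p` of `y` is still orthogonal to `M₁ ⊓ M₂`, so the pair `p`, `y` competes in the
supremum, and `⟨p, y⟩ = ‖p‖²`. -/
theorem norm_starProjection_le_cos_subspaceAngle {M₁ M₂ : Submodule ℂ H}
    [M₁.HasOrthogonalProjection] {y : H} (hy : y ∈ M₂ ⊓ (M₁ ⊓ M₂)ᗮ) :
    ‖M₁.starProjection y‖ ≤ Real.cos (subspaceAngle M₁ M₂) * ‖y‖ := by
  set p := M₁.starProjection y with hp
  have hp1 : p ∈ M₁ := M₁.starProjection_apply_mem y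
  have hpN : p ∈ M₁ ⊓ (M₁ ⊓ M₂)ᗮ := by
    refine ⟨hp1, (Submodule.mem_orthogonal _ _).2 fun w hw => ?_⟩
    rw [hp, ← Submodule.inner_starProjection_left_eq_right,
      Submodule.starProjection_eq_self_iff.2 hw.1]
    exact (Submodule.mem_orthogonal _ _).1 hy.2 w hw
  have h := norm_inner_le_cos_subspaceAngle hpN hy
  have hpp : (inner ℂ p y : ℂ) = inner ℂ p p := by
    rw [hp, ← Submodule.inner_starProjection_left_eq_right,
      starProjection_apply_starProjection_of_le le_rfl]
  rw [hpp, norm_inner_self_eq_mul_norm] at h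
  rcases (norm_nonneg p).eq_or_lt with h0 | h0
  · rw [← h0]
    exact mul_nonneg (cos_subspaceAngle_nonneg _ _) (norm_nonneg _)
  · exact le_of_mul_le_mul_right (by linarith) h0

end Hilbert

/-! ### Schur products and Gram matrices -/

section Schur

open scoped Matrix ComplexOrder

variable {ι : Type*} [Fintype ι]

theorem Matrix.PosSemidef.map_pow {A : Matrix ι ι ℂ} (hA : A.PosSemidef) (k : ℕ) :
    (A.map (· ^ k)).PosSemidef := by
  induction k with
  | zero =>
    convert! Matrix.posSemidef_vecMulVec_self_star (fun _ : ι => (1 : ℂ)) using 1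
    ext i j
    simp [Matrix.vecMulVec_apply]
  | succ k ih =>
    convert! ih.hadamard hA using 1

/-- Induction by telescoping, with entrywise products: `A^{k+1} - B^{k+1} = (A^k - B^k)A + B^k(A -
B)`, and Schur's theorem keeps both terms positive. -/
theorem Matrix.PosSemidef.map_pow_sub_map_pow {A B : Matrix ι ι ℂ} (hB : B.PosSemidef)
    (hAB : (A - B).PosSemidef) (k : ℕ) : (A.map (· ^ k) - B.map (· ^ k)).PosSemidef := by
  have hA : A.PosSemidef := by simpa using hAB.add hB
  induction k with
  | zero =>
    convert! Matrix.PosSemidef.zero (n := ι) (R := ℂ) using 1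
    ext i j
    simp
  | succ k ih =>
    convert! (ih.hadamard hA).add ((hB.map_pow k).hadamard hAB) using 1
    ext i j
    simp [pow_succ]
    ring

/-- Entrywise powers contract increments at the rate of their first order part. -/
theorem Matrix.PosSemidef.smul_map_pow_sub {A G K : Matrix ι ι ℂ} {r : ℝ} (hr : r ≤ 1)
    (hA : A.PosSemidef) (hG : G.PosSemidef) (hK : K.PosSemidef)
    (hGK : ((r : ℂ) • G - K).PosSemidef) (k : ℕ) :
    ((r : ℂ) • ((A + G).map (· ^ k) - A.map (· ^ k)) -
      ((A + K).map (· ^ k) - A.map (· ^ k))).PosSemidef := by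
  have hr' : (0 : ℂ) ≤ ((1 - r : ℝ) : ℂ) := by exact_mod_cast sub_nonneg.2 hr
  -- `G - K = (rG - K) + (1 - r)G`; this is where `r ≤ 1` enters.
  have hsub : (G - K).PosSemidef := by
    convert! hGK.add (hG.smul hr') using 1
    push_cast
    module
  induction k with
  | zero =>
    convert! Matrix.PosSemidef.zero (n := ι) (R := ℂ) using 1
    ext i j
    simp
  | succ k ih =>
    have h2 : ((A + G).map (· ^ k) - (A + K).map (· ^ k)).PosSemidef :=
      (hA.add hK).map_pow_sub_map_pow (by simpa using hsub) k
    -- With `D_k` the matrix of the claim and entrywise products, `D_{k+1} = D_k A + (A+G)^k (rG -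
    -- K) + ((A+G)^k - (A+K)^k) K`.
    convert! ((ih.hadamard hA).add (((hA.add hG).map_pow k).hadamard hGK)).add
      (h2.hadamard hK) using 1
    ext i j
    simp [pow_succ]
    ring

theorem re_star_dotProduct_mulVec (M : Matrix ι ι ℂ) (x : ι → ℂ) :
    (star x ⬝ᵥ M *ᵥ x).re = ∑ i, ∑ j, (star (x i) * (M i j * x j)).re := by
  simp [dotProduct, Matrix.mulVec, Finset.mul_sum, -Complex.mul_re]

/-- The entrywise image of a matrix under the profile of the Bergman kernel. -/
noncomputable def bergmanProfile (n : ℕ) (A : Matrix ι ι ℂ) : Matrix ι ι ℂ :=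
  A.map fun t => 1 / (1 - t) ^ (n + 1)

theorem hasSum_bergmanProfile (n : ℕ) {A : Matrix ι ι ℂ} (hA : ∀ i j, ‖A i j‖ < 1) (x : ι → ℂ) :
    HasSum (fun k : ℕ => ((k + n).choose n : ℝ) * (star x ⬝ᵥ A.map (· ^ k) *ᵥ x).re)
      (star x ⬝ᵥ bergmanProfile n A *ᵥ x).re := by
  simp only [re_star_dotProduct_mulVec, Finset.mul_sum]
  refine hasSum_sum fun i _ => hasSum_sum fun j _ => ?_
  have h := Complex.hasSum_re (((hasSum_choose_mul_geometric_of_norm_lt_one n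
    (hA i j)).mul_right (x j)).mul_left (star (x i)))
  convert! h using 2 with k
  rw [← Complex.re_ofReal_mul]
  congr 1
  simp only [Matrix.map_apply]
  push_cast
  ring

/-- The inequality for entrywise powers is summed against the Taylor coefficients of the profile,
which are nonnegative; the bounds on the entries make the series converge. -/
theorem bergmanProfile_sub_le (n : ℕ) {A G K : Matrix ι ι ℂ} {r : ℝ} (hr : r ≤ 1)
    (hA : A.PosSemidef) (hG : G.PosSemidef) (hK : K.PosSemidef)
    (hGK : ((r : ℂ) • G - K).PosSemidef) (hA1 : ∀ i j, ‖A i j‖ < 1)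
    (hAG : ∀ i j, ‖(A + G) i j‖ < 1) (hAK : ∀ i j, ‖(A + K) i j‖ < 1) (x : ι → ℂ) :
    (star x ⬝ᵥ bergmanProfile n (A + K) *ᵥ x).re - (star x ⬝ᵥ bergmanProfile n A *ᵥ x).re ≤
      r * ((star x ⬝ᵥ bergmanProfile n (A + G) *ᵥ x).re -
        (star x ⬝ᵥ bergmanProfile n A *ᵥ x).re) := by
  have sA := hasSum_bergmanProfile n hA1 x
  refine hasSum_le (fun k => ?_) ((hasSum_bergmanProfile n hAK x).sub sA)
    (((hasSum_bergmanProfile n hAG x).sub sA).mul_left r)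
  have h := (Complex.le_def.1 ((hA.smul_map_pow_sub hr hG hK hGK k).dotProduct_mulVec_nonneg x)).1
  simp only [Matrix.sub_mulVec, Matrix.smul_mulVec, dotProduct_sub, dotProduct_smul, smul_eq_mul,
    Complex.sub_re, Complex.re_ofReal_mul, Complex.zero_re] at h
  have hch : (0 : ℝ) ≤ ((k + n).choose n : ℝ) := Nat.cast_nonneg _
  nlinarith [mul_nonneg hch h]

/-- The quadratic form of a Gram matrix is the squared norm of a linear combination, which stays in
`N`, so the norm bound for `L` applies to it. -/
theorem posSemidef_smul_gram_sub_gram {E : Type*} [NormedAddCommGroup E] [InnerProductSpace ℂ E]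
    {c : ℝ} (L : E →L[ℂ] E) (N : Submodule ℂ E) (hL : ∀ y ∈ N, ‖L y‖ ≤ c * ‖y‖)
    {y : ι → E} (hy : ∀ i, y i ∈ N) :
    (((c ^ 2 : ℝ) : ℂ) • (Matrix.gram ℂ y)ᵀ - (Matrix.gram ℂ fun i => L (y i))ᵀ).PosSemidef := by
  rw [← Matrix.transpose_smul, ← Matrix.transpose_sub]
  refine Matrix.PosSemidef.transpose (Matrix.PosSemidef.of_dotProduct_mulVec_nonneg ?_ fun x => ?_)
  · refine Matrix.IsHermitian.sub ?_ (Matrix.isHermitian_gram ℂ _)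
    exact (Matrix.isHermitian_gram ℂ y).smul (Complex.conj_ofReal _)
  · rw [Matrix.sub_mulVec, Matrix.smul_mulVec, dotProduct_sub, dotProduct_smul,
      Matrix.star_dotProduct_gram_mulVec, Matrix.star_dotProduct_gram_mulVec]
    simp only [← map_smul, ← map_sum]
    have h := hL _ (N.sum_mem fun i (_ : i ∈ Finset.univ) => N.smul_mem (x i) (hy i))
    set v := ∑ i, x i • y i
    rw [inner_self_eq_norm_sq_to_K, inner_self_eq_norm_sq_to_K, smul_eq_mul, sub_nonneg]
    have h2 : ‖L v‖ ^ 2 ≤ c ^ 2 * ‖v‖ ^ 2 := by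
      rw [← mul_pow]
      exact pow_le_pow_left₀ (norm_nonneg _) h 2
    change (‖L v‖ : ℂ) ^ 2 ≤ ((c ^ 2 : ℝ) : ℂ) * (‖v‖ : ℂ) ^ 2
    exact_mod_cast h2

theorem gram_add_gram {κ E : Type*} [NormedAddCommGroup E] [InnerProductSpace ℂ E] {v w : κ → E}
    (h : ∀ i j, (inner ℂ (v i) (w j) : ℂ) = 0) :
    (Matrix.gram ℂ v)ᵀ + (Matrix.gram ℂ w)ᵀ = (Matrix.gram ℂ fun i => v i + w i)ᵀ := by
  ext i j
  simp only [Matrix.add_apply, Matrix.transpose_apply, Matrix.gram_apply, inner_add_left,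
    inner_add_right, h, inner_eq_zero_symm.1 (h i j)]
  ring

/-- Links kernels to matrices. The Gram matrix is transposed because `⟨K_{zᵢ}, K_{zⱼ}⟩` is the
profile of `⟨zⱼ, zᵢ⟩`. -/
theorem norm_sum_smul_bergmanKernel_sq {n : ℕ} (z : ι → ball (0 : EuclideanSpace ℂ (Fin n)) 1)
    (x : ι → ℂ) :
    ‖∑ i, x i • bergmanKernel (z i)‖ ^ 2 =
      (star x ⬝ᵥ bergmanProfile n
        (Matrix.gram ℂ fun i => (z i : EuclideanSpace ℂ (Fin n)))ᵀ *ᵥ x).re := by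
  have h := Matrix.star_dotProduct_gram_mulVec (𝕜 := ℂ) (fun i => bergmanKernel (z i)) x x
  rw [← inner_self_eq_norm_sq (𝕜 := ℂ), ← h]
  change Complex.re _ = _
  congr 3
  ext i j
  rw [Matrix.gram_apply, inner_bergmanKernel]
  rfl

end Schur

/-! ### Quotient modules and the main estimate -/

theorem le_bergmanQuotient_of_le {n : ℕ} {M N : Submodule ℂ (EuclideanSpace ℂ (Fin n))}
    (h : M ≤ N) : bergmanQuotient (M : Set (EuclideanSpace ℂ (Fin n))) ≤
      bergmanQuotient (N : Set (EuclideanSpace ℂ (Fin n))) :=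
  Submodule.topologicalClosure_mono (Submodule.span_mono fun _ ⟨z, hz, hK⟩ => ⟨z, h hz, hK⟩)

/-- The point of the ball obtained by projecting a point of the ball onto a subspace. -/
noncomputable def ballProj {n : ℕ} (M : Submodule ℂ (EuclideanSpace ℂ (Fin n)))
    (z : ball (0 : EuclideanSpace ℂ (Fin n)) 1) : ball (0 : EuclideanSpace ℂ (Fin n)) 1 :=
  ⟨M.starProjection z, mem_ball_zero_iff.2
    ((M.norm_starProjection_apply_le _).trans_lt (mem_ball_zero_iff.1 z.2))⟩

/-- For `u ∈ M` the value `K_z(u)` depends on `z` only through `⟨z, u⟩ = ⟨P_M z, u⟩`, so `K_z -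
K_{P_M z}` is orthogonal to every generator `K_u`. -/
theorem starProjection_bergmanQuotient_bergmanKernel {n : ℕ}
    (M : Submodule ℂ (EuclideanSpace ℂ (Fin n))) (z : ball (0 : EuclideanSpace ℂ (Fin n)) 1) :
    (bergmanQuotient (M : Set (EuclideanSpace ℂ (Fin n)))).starProjection (bergmanKernel z) =
      bergmanKernel (ballProj M z) := by
  refine Submodule.eq_starProjection_of_mem_orthogonal ?_ ?_
  · exact Submodule.le_topologicalClosure _ (Submodule.subset_span
      ⟨ballProj M z, M.starProjection_apply_mem _, rfl⟩)
  · rw [bergmanQuotient, Submodule.orthogonal_closure, Submodule.mem_orthogonal]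
    intro f hf
    induction hf using Submodule.span_induction with
    | mem f hf =>
      obtain ⟨u, hu, rfl⟩ := hf
      rw [inner_sub_right, inner_bergmanKernel, inner_bergmanKernel, sub_eq_zero, bergmanKernelFun,
        bergmanKernelFun]
      change _ = 1 / (1 - inner ℂ (M.starProjection (z : EuclideanSpace ℂ (Fin n)))
        (u : EuclideanSpace ℂ (Fin n))) ^ (n + 1)
      rw [Submodule.inner_starProjection_left_eq_right, Submodule.starProjection_eq_self_iff.2 hu]
    | zero => exact inner_zero_left _
    | add f g _ _ hf hg => rw [inner_add_left, hf, hg, add_zero]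
    | smul a f _ hf => rw [inner_smul_left, hf, mul_zero]

open scoped ComplexOrder in
/-- Passing from `M₂` to its image under the projection onto `M₁` contracts the squared norms of
combinations of kernels, relative to `M₁ ⊓ M₂`. -/
theorem norm_sum_bergmanKernel_ballProj_le {n : ℕ} {ι : Type*} [Fintype ι]
    (M₁ M₂ : Submodule ℂ (EuclideanSpace ℂ (Fin n)))
    {z : ι → ball (0 : EuclideanSpace ℂ (Fin n)) 1}
    (hzM : ∀ i, (z i : EuclideanSpace ℂ (Fin n)) ∈ M₂) (x : ι → ℂ) :
    ‖∑ i, x i • bergmanKernel (ballProj M₁ (z i))‖ ^ 2 -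
        ‖∑ i, x i • bergmanKernel (ballProj (M₁ ⊓ M₂) (z i))‖ ^ 2 ≤
      Real.cos (subspaceAngle M₁ M₂) ^ 2 * (‖∑ i, x i • bergmanKernel (z i)‖ ^ 2 -
        ‖∑ i, x i • bergmanKernel (ballProj (M₁ ⊓ M₂) (z i))‖ ^ 2) := by
  have hy : ∀ i, (z i : EuclideanSpace ℂ (Fin n)) - (M₁ ⊓ M₂).starProjection (z i) ∈
      M₂ ⊓ (M₁ ⊓ M₂)ᗮ := fun i => ⟨M₂.sub_mem (hzM i) ((M₁ ⊓ M₂).starProjection_apply_mem _).2,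
    (M₁ ⊓ M₂).sub_starProjection_mem_orthogonal _⟩
  have hPy : ∀ i, M₁.starProjection
      ((z i : EuclideanSpace ℂ (Fin n)) - (M₁ ⊓ M₂).starProjection (z i)) =
      M₁.starProjection (z i) - (M₁ ⊓ M₂).starProjection (z i) := fun i => by
    rw [map_sub, Submodule.starProjection_eq_self_iff.2
      ((M₁ ⊓ M₂).starProjection_apply_mem (z i : EuclideanSpace ℂ (Fin n))).1]
  -- With `yᵢ = zᵢ - P₃zᵢ`, the orthogonal splittings `zᵢ = P₃zᵢ + yᵢ` and `P₁zᵢ = P₃zᵢ + P₁yᵢ` make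
  -- the Gram matrices `A + G` and `A + K` with a common `A`.
  have hAG := gram_add_gram
    (v := fun i => (M₁ ⊓ M₂).starProjection (z i : EuclideanSpace ℂ (Fin n)))
    (w := fun i => (z i : EuclideanSpace ℂ (Fin n)) - (M₁ ⊓ M₂).starProjection (z i))
    (fun i j => (Submodule.mem_orthogonal _ _).1 (hy j).2 _
      ((M₁ ⊓ M₂).starProjection_apply_mem _))
  have hAK := gram_add_gram
    (v := fun i => (M₁ ⊓ M₂).starProjection (z i : EuclideanSpace ℂ (Fin n)))
    (w := fun i => M₁.starProjection
      ((z i : EuclideanSpace ℂ (Fin n)) - (M₁ ⊓ M₂).starProjection (z i)))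
    (fun i j => by
      rw [← Submodule.inner_starProjection_left_eq_right, Submodule.starProjection_eq_self_iff.2
        ((M₁ ⊓ M₂).starProjection_apply_mem (z i : EuclideanSpace ℂ (Fin n))).1]
      exact (Submodule.mem_orthogonal _ _).1 (hy j).2 _ ((M₁ ⊓ M₂).starProjection_apply_mem _))
  simp only [add_sub_cancel] at hAG
  simp only [hPy, add_sub_cancel] at hAK
  have hlt : ∀ (u : ι → ball (0 : EuclideanSpace ℂ (Fin n)) 1) (i j : ι),
      ‖(Matrix.gram ℂ fun i => (u i : EuclideanSpace ℂ (Fin n))).transpose i j‖ < 1 :=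
    fun u i j => (norm_inner_le_of_mem_ball (u i).2).trans_lt (mem_ball_zero_iff.1 (u j).2)
  have hr : Real.cos (subspaceAngle M₁ M₂) ^ 2 ≤ 1 :=
    pow_le_one₀ (cos_subspaceAngle_nonneg M₁ M₂) (cos_subspaceAngle_lt_one M₁ M₂).le
  have hGK := posSemidef_smul_gram_sub_gram M₁.starProjection (M₂ ⊓ (M₁ ⊓ M₂)ᗮ)
    (fun v hv => norm_starProjection_le_cos_subspaceAngle hv) hy
  simp only [hPy] at hGK
  have key := bergmanProfile_sub_le n hr
    (Matrix.posSemidef_gram ℂ fun i =>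
      (ballProj (M₁ ⊓ M₂) (z i) : EuclideanSpace ℂ (Fin n))).transpose
    (Matrix.posSemidef_gram ℂ _).transpose (Matrix.posSemidef_gram ℂ _).transpose hGK
    (hlt fun i => ballProj (M₁ ⊓ M₂) (z i))
    (fun i j => by
      simp only [ballProj, hAG]
      exact hlt z i j)
    (fun i j => by
      simp only [ballProj, hAK]
      exact hlt (fun i => ballProj M₁ (z i)) i j) x
  simp only [norm_sum_smul_bergmanKernel_sq]
  simp only [ballProj, hAG, hAK] at key ⊢
  exact key

theorem norm_starProjection_sub_le_of_mem_bergmanQuotient {n : ℕ}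
    (M₁ M₂ : Submodule ℂ (EuclideanSpace ℂ (Fin n))) {f : bergmanSpace n}
    (hf : f ∈ bergmanQuotient (M₂ : Set (EuclideanSpace ℂ (Fin n)))) :
    ‖(bergmanQuotient (M₁ : Set (EuclideanSpace ℂ (Fin n)))).starProjection f -
      (bergmanQuotient
        ((M₁ ⊓ M₂ : Submodule ℂ (EuclideanSpace ℂ (Fin n))) :
          Set (EuclideanSpace ℂ (Fin n)))).starProjection f‖ ≤
      Real.cos (subspaceAngle M₁ M₂) * ‖f‖ := by
  set M₃ : Submodule ℂ (EuclideanSpace ℂ (Fin n)) := M₁ ⊓ M₂ with hM₃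
  set Q₁ := bergmanQuotient (M₁ : Set (EuclideanSpace ℂ (Fin n)))
  set Q₃ := bergmanQuotient (M₃ : Set (EuclideanSpace ℂ (Fin n)))
  set c := Real.cos (subspaceAngle M₁ M₂)
  have hc0 : 0 ≤ c := cos_subspaceAngle_nonneg M₁ M₂
  have hc1 : c < 1 := cos_subspaceAngle_lt_one M₁ M₂
  have hQ : Q₃ ≤ Q₁ := le_bergmanQuotient_of_le inf_le_left
  have hclosed : IsClosed {f : bergmanSpace n |
      ‖Q₁.starProjection f - Q₃.starProjection f‖ ≤ c * ‖f‖} :=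
    isClosed_le (by fun_prop) (by fun_prop)
  -- Both sides are continuous in `f`, so finite combinations of kernels suffice.
  refine closure_minimal (fun f hf => ?_) hclosed hf
  obtain ⟨m, x, g, rfl⟩ := Submodule.mem_span_set'.1 hf
  choose z hzM hzK using fun i => (g i).2
  simp only [hzK, Set.mem_ofPred_eq]
  set F := ∑ i, x i • bergmanKernel (z i)
  have hQF : ∀ M : Submodule ℂ (EuclideanSpace ℂ (Fin n)),
      (bergmanQuotient (M : Set (EuclideanSpace ℂ (Fin n)))).starProjection F =
        ∑ i, x i • bergmanKernel (ballProj M (z i)) := fun M => by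
    simp only [F, map_sum, map_smul, starProjection_bergmanQuotient_bergmanKernel]
  have key := norm_sum_bergmanKernel_ballProj_le M₁ M₂ hzM x
  rw [← hQF, ← hQF] at key
  -- As `Q₃Q₁ = Q₃`, Pythagoras turns the difference of squared norms into `‖Q₁F - Q₃F‖²`.
  have hpyth := norm_sub_starProjection_sq Q₃ (Q₁.starProjection F)
  rw [starProjection_apply_starProjection_of_le hQ] at hpyth
  refine (sq_le_sq₀ (norm_nonneg _) (by positivity)).1 ?_
  rw [hpyth, mul_pow]
  exact key.trans (mul_le_mul_of_nonneg_left (sub_le_self _ (sq_nonneg _)) (sq_nonneg _))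

theorem mainTheorem2 :
    ∃ a : ℝ → ℝ, ∀ (n : ℕ) (M₁ M₂ M₃ : Submodule ℂ (EuclideanSpace ℂ (Fin n))),
      M₃ = M₁ ⊓ M₂ →
      ‖bergmanProj (M₂ : Set (EuclideanSpace ℂ (Fin n))) ∘L
            bergmanProj (M₁ : Set (EuclideanSpace ℂ (Fin n))) ∘L
            bergmanProj (M₂ : Set (EuclideanSpace ℂ (Fin n))) -
          bergmanProj (M₃ : Set (EuclideanSpace ℂ (Fin n)))‖ ≤ a (subspaceAngle M₁ M₂) ∧
        a (subspaceAngle M₁ M₂) < 1 ∧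
        IsClosed ((bergmanQuotient (M₁ : Set (EuclideanSpace ℂ (Fin n))) ⊔
          bergmanQuotient (M₂ : Set (EuclideanSpace ℂ (Fin n))) :
            Submodule ℂ (bergmanSpace n)) : Set (bergmanSpace n)) ∧
        bergmanQuotient (M₁ : Set (EuclideanSpace ℂ (Fin n))) ⊓
            bergmanQuotient (M₂ : Set (EuclideanSpace ℂ (Fin n))) =
          bergmanQuotient (M₃ : Set (EuclideanSpace ℂ (Fin n))) := by
  -- The square reflects `Q₂Q₁Q₂ - Q₃ = T*T` with `T = (Q₁ - Q₃)Q₂` of norm at most `cos θ`.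
  refine ⟨fun θ => Real.cos θ ^ 2, ?_⟩
  rintro n M₁ M₂ _ rfl
  have hc0 := cos_subspaceAngle_nonneg M₁ M₂
  have hc1 := cos_subspaceAngle_lt_one M₁ M₂
  have hQ1 := le_bergmanQuotient_of_le (inf_le_left : M₁ ⊓ M₂ ≤ M₁)
  have hQ2 := le_bergmanQuotient_of_le (inf_le_right : M₁ ⊓ M₂ ≤ M₂)
  have h := fun f hf => norm_starProjection_sub_le_of_mem_bergmanQuotient M₁ M₂ (f := f) hf
  exact ⟨norm_starProjection_comp_sub_le hQ1 hQ2 hc0 h, pow_lt_one₀ hc0 hc1 two_ne_zero,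
    isClosed_sup_of_norm_starProjection_sub_le (Submodule.isClosed_topologicalClosure _)
      hQ1 hQ2 hc1 h,
    inf_eq_of_norm_starProjection_sub_le hQ1 hQ2 hc1 h⟩
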